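/- **Notation.** For a set $S$ of primes let $\mathbb Z_S\subseteq\mathbb Q$ be the localization of $\mathbb Z$ at the nonzero integers divisible by no prime of $S$ (so $\mathbb Z_{(p)}=\mathbb Z_{\{p\}}$). Let $\Gamma$ be a finite group and $\Gamma'\le\Gamma$. Put $a_{\Gamma/\Gamma'}=\operatorname{Ind}_{\Gamma'}^{\Gamma}1-1$, $a_\Gamma=a_{\Gamma/1}$ and $e_1'=|\Gamma'|^{-1}\sum_{\tau\in\Gamma'}\tau$. Let $e_{\Gamma/\Gamma'}\in\mathbb Q[\Gamma]$ be the central idempotent associated to $a_{\Gamma/\Gamma'}$, i.e. the minimal central idempotent acting as the identity on a $\mathbb Q$-representation with character $a_{\Gamma/\Gamma'}$. A prime $p$ is *good* for a central idempotent $e\in\mathbb Q[\Gamma]$ if $e\in\mathbb Z_{(p)}[\Gamma]$ and $e\mathbb Z_{(p)}[\Gamma]$ is a maximal $\mathbb Z_{(p)}$-order in $e\mathbb Q[\Gamma]$. For a $\mathbb Z_S$-order $\mathcal O$ in $\mathbb Q[\Gamma]$, a left superscript ${}^{\Gamma'}(\cdot)$ denotes the elements fixed by left multiplication by $\Gamma'$,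 and $\mathfrak o={}^{\Gamma'}(e_{\Gamma/\Gamma'}\mathcal O e_1')$, a ring with identity $e_{\Gamma/\Gamma'}e_1'$. *Rank.* Let $L/K_0$ be a Galois extension of number fields with group $\Gamma$. For each infinite place $v$ of $K_0$ let $\Gamma_v$ be a decomposition group at $v$, and put $\chi_L=-1+\sum_{v\mid\infty}\operatorname{Ind}_{\Gamma_v}^{\Gamma}1$. Let $e_i$ run over the irreducible central idempotents of $\mathbb Q[\Gamma]$ contained in $e_{\Gamma/\Gamma'}$, let $\varphi_i$ be any absolutely irreducible character contained in the irreducible rational character attached to $e_i$, and let $h_i^2$ be the dimension of $e_i\mathbb Q[\Gamma]$ over its center. The rank of $L^{\Gamma'}/K_0$ computed via $L$ is $\underline v=(v_i)$ with $$v_i=\frac{\langle\varphi_i,a_\Gamma\rangle}{\langle\varphi_i,a_{\Gamma/\Gamma'}\rangle}\,u_i,\qquad u_i=\frac1{h_i}\langle\chi_L,\varphi_i\rangle .$$ *Predicted distribution.* For a maximal $\mathbb Z_S$-order $\mathcal O$ and a finite $\mathfrak o$-module $H$ put $|H|^{\underline v}=\prod_i|e_ie_1'H|^{v_i}$. A random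 finite $\mathfrak o$-module has the distribution predicted by Cohen–Martinet for $(\mathfrak o,\underline v)$ if the probability of each isomorphism class $H$ is inversely proportional to $|H|^{\underline v}\,|\operatorname{Aut}_{\mathfrak o}(H)|$. **Theorem.** Let $K/K_0$ be a finite extension of number fields with Galois closure $L/K_0$, and let $M\supseteq L$ be a finite Galois extension of $K_0$. Let $\Gamma\cong\operatorname{Gal}(L/K_0)$ and $\Sigma\cong\operatorname{Gal}(M/K_0)$, let $\Gamma'\le\Gamma$ and $\Sigma'\le\Sigma$ be the subgroups corresponding to $\operatorname{Gal}(L/K)$ and $\operatorname{Gal}(M/K)$, let $\pi:\Sigma\to\Gamma$ be the surjection given by restriction, and let $\Delta=\ker\pi\cong\operatorname{Gal}(M/L)$. Let $S$ be a set of primes that are good both for $e_{\Gamma/\Gamma'}\in\mathbb Q[\Gamma]$ and for $e_{\Sigma/\Sigma'}\in\mathbb Q[\Sigma]$. Let $F:\mathbb Q[\Gamma]\to\mathbb Q[\Sigma]$ be the non-unital algebra embedding $\gamma\mapsto|\Delta|^{-1}\,\sigma\sum_{\delta\in\Delta}\delta$, where $\pi(\sigma)=\gamma$. 1. The map $F$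 restricts to a bijection from the irreducible central idempotents contained in $e_{\Gamma/\Gamma'}$ to those contained in $e_{\Sigma/\Sigma'}$. Under this bijection the rank $\underline v$ of $K=L^{\Gamma'}$ over $K_0$ computed via $L$ equals the rank $\tilde{\underline v}$ of $K=M^{\Sigma'}$ over $K_0$ computed via $M$ (for all choices of the absolutely irreducible characters). 2. Let $\mathcal O\subseteq\mathbb Q[\Gamma]$ and $\widetilde{\mathcal O}\subseteq\mathbb Q[\Sigma]$ be maximal $\mathbb Z_S$-orders such that the linear map $\gamma\mapsto\sigma\sum_{\delta\in\Delta}\delta$ $(\pi(\sigma)=\gamma)$ maps $\mathcal O$ into $\widetilde{\mathcal O}$. Then $F$ restricts to an isomorphism of additive groups ${}^{\Gamma'}(e_{\Gamma/\Gamma'}\mathcal O)\cong{}^{\Sigma'}(e_{\Sigma/\Sigma'}\widetilde{\mathcal O})$, and to a ring isomorphism $\theta:\mathfrak o={}^{\Gamma'}(e_{\Gamma/\Gamma'}\mathcal Oe_1')\cong\tilde{\mathfrak o}={}^{\Sigma'}(e_{\Sigma/\Sigma'}\widetilde{\mathcal O}E_1')$, where $E_1'=|\Sigma'|^{-1}\sum_{\sigma\in\Sigma'}\sigma$.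 3. In the situation of 2, if a finite $\mathfrak o$-module $H$ and a finite $\tilde{\mathfrak o}$-module $\widetilde H$ correspond to each other through $\theta$, then $|H|^{\underline v}=|\widetilde H|^{\tilde{\underline v}}$. Moreover, any distribution predicted for $(\mathfrak o,\underline v)$ and any distribution predicted for $(\tilde{\mathfrak o},\tilde{\underline v})$ give $H$ and $\widetilde H$ the same probability. So the predicted distributions obtained via $L$ and via $M$ agree. -/

import Mathlib

open scoped BigOperators

noncomputable section

namespace CohenMartinet

/-! ### `ℤ_S`, orders and maximal orders -/

/-- `ℤ_S`: the localization of `ℤ` at the nonzero integers not divisible by any prime of `S`,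
as a subring of `ℚ`. In particular `ZS {p}` is `ℤ_(p)` and `ZS ∅` is `ℚ`. -/
def ZS (S : Set Nat.Primes) : Subring ℚ where
  carrier := {q | ∃ a b : ℤ, (∀ p ∈ S, ¬ ((p : ℕ) : ℤ) ∣ b) ∧ b ≠ 0 ∧ q = a / b}
  mul_mem' := by
    rintro _ _ ⟨a, b, hb, hb0, rfl⟩ ⟨c, d, hd, hd0, rfl⟩
    refine ⟨a * c, b * d, fun p hp h => ?_, mul_ne_zero hb0 hd0, ?_⟩
    · rcases (Nat.prime_iff_prime_int.mp p.2).dvd_or_dvd h with h | h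
      exacts [hb p hp h, hd p hp h]
    · push_cast; rw [div_mul_div_comm]
  one_mem' := ⟨1, 1, fun p _ h =>
    (Nat.prime_iff_prime_int.mp p.2).not_isUnit (isUnit_of_dvd_one h), one_ne_zero, by simp⟩
  add_mem' := by
    rintro _ _ ⟨a, b, hb, hb0, rfl⟩ ⟨c, d, hd, hd0, rfl⟩
    refine ⟨a * d + b * c, b * d, fun p hp h => ?_, mul_ne_zero hb0 hd0, ?_⟩
    · rcases (Nat.prime_iff_prime_int.mp p.2).dvd_or_dvd h with h | h
      exacts [hb p hp h, hd p hp h]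
    · have h1 : (b : ℚ) ≠ 0 := by exact_mod_cast hb0
      have h2 : (d : ℚ) ≠ 0 := by exact_mod_cast hd0
      push_cast; rw [div_add_div _ _ h1 h2]
  zero_mem' := ⟨0, 1, fun p _ h =>
    (Nat.prime_iff_prime_int.mp p.2).not_isUnit (isUnit_of_dvd_one h), one_ne_zero, by simp⟩
  neg_mem' := by
    rintro _ ⟨a, b, hb, hb0, rfl⟩
    exact ⟨-a, b, hb, hb0, by push_cast; rw [neg_div]⟩

/-- `ℤ_S`-submodules of a `ℚ`-algebra. -/
abbrev ZSub (S : Set Nat.Primes) (A : Type*) [Ring A] [Algebra ℚ A] := Submodule (ZS S) A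

/-- `Λ` is a `ℤ_S`-order in the `ℚ`-algebra `f A f` (with identity `f`), where `f` is an
idempotent of `A`. For `f = 1` this is an order in `A`; for `f` central it is an order in `f A`. -/
structure IsOrder (S : Set Nat.Primes) {A : Type*} [Ring A] [Algebra ℚ A] (f : A)
    (Λ : ZSub S A) : Prop where
  le_corner : ∀ x ∈ Λ, f * x = x ∧ x * f = x
  one_mem : f ∈ Λ
  mul_mem : ∀ x ∈ Λ, ∀ y ∈ Λ, x * y ∈ Λ
  fg : Λ.FG
  spans : ∀ x : A, f * x = x → x * f = x → x ∈ Submodule.span ℚ (Λ : Set A)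

/-- `Λ` is a maximal `ℤ_S`-order in `f A f`. -/
def IsMaximalOrder (S : Set Nat.Primes) {A : Type*} [Ring A] [Algebra ℚ A] (f : A)
    (Λ : ZSub S A) : Prop :=
  IsOrder S f Λ ∧ ∀ Λ' : ZSub S A, IsOrder S f Λ' → Λ ≤ Λ' → Λ' = Λ

/-- `a Λ = {a x : x ∈ Λ}`. -/
def lmul {S : Set Nat.Primes} {A : Type*} [Ring A] [Algebra ℚ A] (a : A) (Λ : ZSub S A) :
    ZSub S A := Λ.map ((LinearMap.mulLeft ℚ a).restrictScalars (ZS S))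

/-- `Λ a = {x a : x ∈ Λ}`. -/
def rmul {S : Set Nat.Primes} {A : Type*} [Ring A] [Algebra ℚ A] (Λ : ZSub S A) (a : A) :
    ZSub S A := Λ.map ((LinearMap.mulRight ℚ a).restrictScalars (ZS S))

/-! ### Idempotents -/

/-- `e` is a central idempotent. -/
def IsCentralIdem {A : Type*} [Ring A] (e : A) : Prop :=
  IsIdempotentElem e ∧ ∀ x, e * x = x * e

/-- `ε` is an irreducible central idempotent. -/
def IsIrredCentralIdem {A : Type*} [Ring A] (ε : A) : Prop :=
  IsCentralIdem ε ∧ ε ≠ 0 ∧ ∀ f : A, IsCentralIdem f → ε * f = 0 ∨ ε * f = ε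

/-- The irreducible central idempotents `ε` contained in the central idempotent `e`. -/
abbrev Comp {A : Type*} [Ring A] (e : A) := {ε : A // IsIrredCentralIdem ε ∧ ε * e = ε}

/-- The number `h` with `h ^ 2 = dim_Z (ε A)`, `Z` the center of the simple algebra `ε A`. -/
def hdim {A : Type*} [Ring A] (ε : A) (hε : IsIrredCentralIdem ε) : ℕ :=
  Nat.sqrt (Module.finrank (Subring.center hε.1.1.Corner) hε.1.1.Corner)

section Group

variable {G : Type*} [Group G] [Fintype G]

/-- `ℤ_S[G] ⊆ ℚ[G]`. -/
def groupRing (S : Set Nat.Primes) (G : Type*) [Group G] : ZSub S (MonoidAlgebra ℚ G) :=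
  Submodule.span (ZS S) (Set.range (MonoidAlgebra.of ℚ G))

/-- The prime `p` is good for the central idempotent `e` of `ℚ[G]`: `e ∈ ℤ_(p)[G]` and
`e ℤ_(p)[G]` is a maximal `ℤ_(p)`-order in `e ℚ[G]`. -/
def IsGoodPrime (p : Nat.Primes) (e : MonoidAlgebra ℚ G) : Prop :=
  e ∈ groupRing {p} G ∧ IsMaximalOrder {p} e (lmul e (groupRing {p} G))

/-- `e₁' = |H|⁻¹ ∑_{τ ∈ H} τ`. -/
def avg (H : Subgroup G) : MonoidAlgebra ℚ G :=
  open Classical in (Nat.card H : ℚ)⁻¹ • ∑ τ : H, MonoidAlgebra.of ℚ G (τ : G)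

theorem of_mul_avg (H : Subgroup G) {h : G} (hh : h ∈ H) :
    MonoidAlgebra.of ℚ G h * avg H = avg H := by
  classical
  unfold avg
  rw [mul_smul_comm, Finset.mul_sum]
  congr 1
  refine Fintype.sum_equiv (Equiv.mulLeft (⟨h, hh⟩ : H)) _ _ fun τ => ?_
  simp only [Equiv.coe_mulLeft, Subgroup.coe_mul, map_mul]

theorem avg_isIdempotentElem (H : Subgroup G) : IsIdempotentElem (avg H) := by
  classical
  have h0 : (Nat.card H : ℚ) ≠ 0 := by exact_mod_cast Nat.card_pos.ne'
  unfold IsIdempotentElem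
  conv_lhs => enter [1]; unfold avg
  rw [smul_mul_assoc, Finset.sum_mul, Finset.sum_congr rfl fun τ _ => of_mul_avg H τ.2,
    Finset.sum_const, Finset.card_univ, ← Nat.card_eq_fintype_card, ← Nat.cast_smul_eq_nsmul ℚ,
    smul_smul, inv_mul_cancel₀ h0, one_smul]

/-- The central idempotent `f` of `ℚ[G]` acts as the identity on the augmentation representation,
the representation on the vectors of coefficient sum `0` in the permutation module `ℚ[G / H]`;
its character is `a_{G/H} = Ind_H^G 1 - 1`. -/
def ActsTriviallyOnAug (H : Subgroup G) (f : MonoidAlgebra ℚ G) : Prop :=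
  ∀ v : MonoidAlgebra ℚ (G ⧸ H), (v.coeff.sum fun _ a => a) = 0 →
    (Representation.ofMulAction ℚ G (G ⧸ H)).asAlgebraHom f v = v

/-- `e` is the minimal central idempotent acting as the identity on the augmentation
representation. -/
def IsAugIdem (H : Subgroup G) (e : MonoidAlgebra ℚ G) : Prop :=
  (IsCentralIdem e ∧ ActsTriviallyOnAug H e) ∧
    ∀ f, IsCentralIdem f → ActsTriviallyOnAug H f → e * f = e

theorem exists_isAugIdem (H : Subgroup G) : ∃ e, IsAugIdem H e := by
  classical
  let P : MonoidAlgebra ℚ G → Prop := fun e => IsCentralIdem e ∧ ActsTriviallyOnAug H e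
  have hfin : FiniteDimensional ℚ (MonoidAlgebra ℚ G) :=
    Module.Finite.equiv (MonoidAlgebra.coeffLinearEquiv ℚ (S := ℚ) (M := G)).symm
  let d : MonoidAlgebra ℚ G → ℕ := fun e =>
    Module.finrank ℚ (LinearMap.range (LinearMap.mulLeft ℚ e))
  have hP1 : P 1 := ⟨⟨IsIdempotentElem.one, fun x => by simp⟩, fun v _ => by simp⟩
  have hex : ∃ n, ∃ e, P e ∧ d e = n := ⟨_, 1, hP1, rfl⟩
  obtain ⟨e, he, hd⟩ := Nat.find_spec hex
  refine ⟨e, he, fun f hf hfa => ?_⟩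
  have hef : P (e * f) := by
    refine ⟨⟨?_, fun x => ?_⟩, fun v hv => ?_⟩
    · exact IsIdempotentElem.mul_of_commute (he.1.2 f) he.1.1 hf.1
    · rw [mul_assoc, hf.2 x, ← mul_assoc, he.1.2 x, mul_assoc]
    · rw [map_mul, Module.End.mul_apply, hfa v hv, he.2 v hv]
  have hle : LinearMap.range (LinearMap.mulLeft ℚ (e * f)) ≤
      LinearMap.range (LinearMap.mulLeft ℚ e) := by
    rintro _ ⟨x, rfl⟩
    exact ⟨f * x, by simp⟩
  have hmin : d e ≤ d (e * f) := by
    rw [hd]; exact Nat.find_min' hex ⟨_, hef, rfl⟩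
  have heq := Submodule.eq_of_le_of_finrank_le hle hmin
  have hmem : e ∈ LinearMap.range (LinearMap.mulLeft ℚ (e * f)) := by
    rw [heq]; exact ⟨1, by simp⟩
  obtain ⟨x, hx⟩ := hmem
  simp only [LinearMap.mulLeft_apply] at hx
  calc e * f = (e * f) * x * f := by rw [hx]
    _ = e * f * x := by
      rw [mul_assoc (e * f) x f, ← hf.2 x, ← mul_assoc, mul_assoc e f f, hf.1.eq]
    _ = e := hx

/-- `e_{G/H}`: the central idempotent of `ℚ[G]` associated to the augmentation character
`a_{G/H}`. -/
def augIdem (H : Subgroup G) : MonoidAlgebra ℚ G := (exists_isAugIdem H).choose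

theorem augIdem_spec (H : Subgroup G) : IsAugIdem H (augIdem H) := (exists_isAugIdem H).choose_spec

/-! ### Characters and ranks -/

/-- The inner product `⟨a, b⟩ = |G|⁻¹ ∑_g a(g) conj(b(g))` of class functions. -/
def cinner (a b : G → ℂ) : ℂ := (Nat.card G : ℂ)⁻¹ * ∑ g, a g * (starRingEnd ℂ) (b g)

/-- The character of `G` induced from the unit character of `H`. -/
def indUnit (H : Subgroup G) (g : G) : ℂ :=
  (Nat.card H : ℂ)⁻¹ * Nat.card {x : G // x⁻¹ * g * x ∈ H}

/-- The augmentation character `a_{G/H} = Ind_H^G 1 - 1`. -/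
def augChar (H : Subgroup G) (g : G) : ℂ := indUnit H g - 1

/-- `φ` is an absolutely irreducible character of `G` contained in the irreducible rational
character associated to the irreducible central idempotent `ε` of `ℚ[G]`, the character of the
irreducible rational representation on which `ε` acts as the identity. -/
def IsAbsIrrCharIn (ε : MonoidAlgebra ℚ G) (φ : G → ℂ) : Prop :=
  ∃ (n : ℕ) (ρ : Representation ℚ G (Fin n → ℚ)) (m : ℕ) (σ : Representation ℂ G (Fin m → ℂ)),
    ρ.IsIrreducible ∧ ρ.asAlgebraHom ε = 1 ∧ σ.IsIrreducible ∧ (∀ g, φ g = σ.character g) ∧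
      cinner φ (fun g => ((ρ.character g : ℚ) : ℂ)) ≠ 0

section Fields

variable (K₀ L : Type*) [Field K₀] [NumberField K₀] [Field L] [Algebra K₀ L]
  [FiniteDimensional K₀ L]

/-- A decomposition group in `G ≅ Gal(L/K₀)` of the infinite place `v` of `K₀`: the stabilizer
of a chosen infinite place of `L` above `v`. It is well defined up to conjugation. -/
def decompGroup (τ : Gal(L/K₀) ≃* G) (v : NumberField.InfinitePlace K₀) : Subgroup G :=
  (MulAction.stabilizer Gal(L/K₀)
    (NumberField.InfinitePlace.comap_surjective (k := K₀) (K := L) v).choose).map τ.toMonoidHom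

/-- `χ_L = -1 + ∑_{v ∣ ∞} Ind_{G_v}^G 1`. -/
def infChar (τ : Gal(L/K₀) ≃* G) (g : G) : ℂ :=
  -1 + ∑ v : NumberField.InfinitePlace K₀, indUnit (decompGroup K₀ L τ v) g

/-- The coordinate `u_ε = h⁻¹ ⟨χ_L, φ⟩` at `ε` of the rank of the Galois extension `L/K₀`. -/
def galRank (τ : Gal(L/K₀) ≃* G) (ε : MonoidAlgebra ℚ G) (hε : IsIrredCentralIdem ε)
    (φ : G → ℂ) : ℂ :=
  (hdim ε hε : ℂ)⁻¹ * cinner (infChar K₀ L τ) φ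

/-- The rank of `L^H/K₀` computed in `L`: the family
`v_ε = ⟨φ_ε, a_G⟩ / ⟨φ_ε, a_{G/H}⟩ * u_ε` indexed by the irreducible central idempotents `ε`
contained in `e_{G/H}`, where `φ_ε` is a choice of absolutely irreducible characters. These
numbers are rational. -/
def fixedRank (τ : Gal(L/K₀) ≃* G) (H : Subgroup G) (φ : Comp (augIdem H) → G → ℂ)
    (ε : Comp (augIdem H)) : ℂ :=
  cinner (φ ε) (augChar ⊥) / cinner (φ ε) (augChar H) * galRank K₀ L τ ε.1 ε.2.1 (φ ε)

/-- The image in `G ≅ Gal(L/K₀)` of `Gal(L/K)`, for `K₀ ⊆ K ⊆ L`. -/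
def galImage (K : Type*) [Field K] [Algebra K₀ K] [Algebra K L] [IsScalarTower K₀ K L]
    (τ : Gal(L/K₀) ≃* G) : Subgroup G :=
  ((IsScalarTower.toAlgHom K₀ K L).fieldRange.fixingSubgroup).map τ.toMonoidHom

end Fields

/-! ### Invariants and the ring `𝔬` -/

/-- `^H Λ`: the elements of `Λ ⊆ ℚ[G]` fixed by left multiplication by the elements of `H`. -/
def leftInv {S : Set Nat.Primes} (H : Subgroup G) (Λ : ZSub S (MonoidAlgebra ℚ G)) :
    ZSub S (MonoidAlgebra ℚ G) where
  carrier := {x | x ∈ Λ ∧ ∀ τ ∈ H, MonoidAlgebra.of ℚ G τ * x = x}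
  add_mem' := fun ha hb => ⟨Λ.add_mem ha.1 hb.1, fun τ hτ => by
    rw [mul_add, ha.2 τ hτ, hb.2 τ hτ]⟩
  zero_mem' := ⟨Λ.zero_mem, fun τ _ => mul_zero _⟩
  smul_mem' := fun c x hx => ⟨Λ.smul_mem c hx.1, fun τ hτ => by
    have := hx.2 τ hτ
    rw [Subring.smul_def, mul_smul_comm, this]⟩

theorem avg_mul_of_leftInv (H : Subgroup G) {x : MonoidAlgebra ℚ G}
    (hx : ∀ τ ∈ H, MonoidAlgebra.of ℚ G τ * x = x) : avg H * x = x := by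
  classical
  have h0 : (Nat.card H : ℚ) ≠ 0 := by exact_mod_cast Nat.card_pos.ne'
  unfold avg
  rw [smul_mul_assoc, Finset.sum_mul, Finset.sum_congr rfl fun (τ : H) _ => hx τ τ.2,
    Finset.sum_const, Finset.card_univ, ← Nat.card_eq_fintype_card, ← Nat.cast_smul_eq_nsmul ℚ,
    smul_smul, inv_mul_cancel₀ h0, one_smul]

/-- `e_{G/H} e₁'` is an idempotent; it is the identity of `e₁' e_{G/H} ℚ[G] e₁'`. -/
theorem augAvg_isIdempotentElem (H : Subgroup G) : IsIdempotentElem (augIdem H * avg H) :=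
  IsIdempotentElem.mul_of_commute ((augIdem_spec H).1.1.2 _) (augIdem_spec H).1.1.1
    (avg_isIdempotentElem H)

/-- The underlying module `^H(e_{G/H} 𝒪 e₁')` of `𝔬`. -/
def heckeModule {S : Set Nat.Primes} (H : Subgroup G) (O : ZSub S (MonoidAlgebra ℚ G)) :
    ZSub S (MonoidAlgebra ℚ G) :=
  leftInv H (rmul (lmul (augIdem H) O) (avg H))

theorem exists_of_mem_heckeModule {S : Set Nat.Primes} {H : Subgroup G}
    {O : ZSub S (MonoidAlgebra ℚ G)} {x : MonoidAlgebra ℚ G} (hx : x ∈ heckeModule H O) :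
    (∃ a ∈ O, x = augIdem H * a * avg H) ∧ ∀ τ ∈ H, MonoidAlgebra.of ℚ G τ * x = x := by
  obtain ⟨⟨_, ⟨a, ha, rfl⟩, rfl⟩, hx⟩ := hx
  exact ⟨⟨a, ha, rfl⟩, hx⟩

/-- The ring `𝔬 = ^H(e_{G/H} 𝒪 e₁')`, as a subring of `e₁' e_{G/H} ℚ[G] e₁'`, for an order `𝒪`
of `ℚ[G]`. -/
def heckeRing {S : Set Nat.Primes} (H : Subgroup G) (O : ZSub S (MonoidAlgebra ℚ G))
    (hO : IsOrder S 1 O) : Subring (augAvg_isIdempotentElem H).Corner where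
  carrier := {x | x.1 ∈ heckeModule H O}
  mul_mem' := by
    rintro x y hx hy
    obtain ⟨⟨a, ha, hxa⟩, hx2⟩ := exists_of_mem_heckeModule hx
    obtain ⟨⟨b, hb, hyb⟩, hy2⟩ := exists_of_mem_heckeModule hy
    have hc := (augIdem_spec H).1.1.2
    have hi := (augIdem_spec H).1.1.1.eq
    refine ⟨⟨_, ⟨a * b, hO.mul_mem a ha b hb, rfl⟩, ?_⟩, fun τ hτ => ?_⟩
    · change augIdem H * (a * b) * avg H = x.1 * y.1
      rw [hxa, mul_assoc _ (avg H), avg_mul_of_leftInv H hy2, hyb]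
      calc augIdem H * (a * b) * avg H = (augIdem H * augIdem H) * a * b * avg H := by
            rw [hi]; simp only [mul_assoc]
        _ = augIdem H * (augIdem H * a) * b * avg H := by simp only [mul_assoc]
        _ = augIdem H * (a * augIdem H) * b * avg H := by rw [hc a]
        _ = augIdem H * a * (augIdem H * b * avg H) := by simp only [mul_assoc]
    · change _ * (x.1 * y.1) = x.1 * y.1
      rw [← mul_assoc, hx2 τ hτ]
  one_mem' := by
    refine ⟨⟨_, ⟨1, hO.one_mem, rfl⟩, ?_⟩, fun τ hτ => ?_⟩
    · change augIdem H * 1 * avg H = augIdem H * avg H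
      rw [mul_one]
    · change _ * (augIdem H * avg H) = augIdem H * avg H
      rw [← mul_assoc, ← (augIdem_spec H).1.1.2, mul_assoc, of_mul_avg H hτ]
  add_mem' := fun ha hb => (heckeModule H O).add_mem ha hb
  zero_mem' := (heckeModule H O).zero_mem
  neg_mem' := fun ha => (heckeModule H O).neg_mem ha

/-- The element of `ℚ[G]` underlying an element of `𝔬`. -/
def heckeVal {S : Set Nat.Primes} {H : Subgroup G} {O : ZSub S (MonoidAlgebra ℚ G)}
    {hO : IsOrder S 1 O} (x : heckeRing H O hO) : MonoidAlgebra ℚ G := x.1.1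

/-! ### Random finite modules -/

/-- Finite modules over a ring. -/
structure FinMod (R : Type*) [Ring R] where
  carrier : Type
  [addCommGroup : AddCommGroup carrier]
  [module : Module R carrier]
  [finite : Finite carrier]

attribute [instance] FinMod.addCommGroup FinMod.module FinMod.finite

/-- Isomorphism of finite modules. -/
instance finModSetoid (R : Type*) [Ring R] : Setoid (FinMod R) where
  r X Y := Nonempty (X.carrier ≃ₗ[R] Y.carrier)
  iseqv := ⟨fun X => ⟨LinearEquiv.refl R X.carrier⟩, fun ⟨f⟩ => ⟨f.symm⟩,
    fun ⟨f⟩ ⟨g⟩ => ⟨f.trans g⟩⟩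

/-- Isomorphism classes of finite modules. -/
abbrev FinModClass (R : Type*) [Ring R] := Quotient (finModSetoid R)

/-- The component `(ε e₁') X` of an `𝔬`-module `X` at `ε`; here `ε e₁' ∈ 𝔬`, as the maximal
order `𝒪` contains the central idempotents of `ℚ[G]`. -/
def compPart {S : Set Nat.Primes} {H : Subgroup G} {O : ZSub S (MonoidAlgebra ℚ G)}
    {hO : IsOrder S 1 O} (ε : Comp (augIdem H)) (X : FinMod (heckeRing H O hO)) :
    Set X.carrier :=
  {x | ∃ a : heckeRing H O hO, heckeVal a = ε.1 * avg H ∧ ∃ y : X.carrier, x = a • y}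

/-- `|X|^v = ∏_ε |(ε e₁') X| ^ v_ε` for a family `v` of (rational) exponents. -/
def cardPow {S : Set Nat.Primes} {H : Subgroup G} {O : ZSub S (MonoidAlgebra ℚ G)}
    {hO : IsOrder S 1 O} (v : Comp (augIdem H) → ℂ) (X : FinMod (heckeRing H O hO)) : ℝ :=
  ∏ᶠ ε, ((compPart ε X).ncard : ℝ) ^ (v ε).re

/-- `P` is the distribution of the random finite `𝔬`-module with exponents `v`:
the probability of `X` is inversely proportional to `|X|^v |Aut_𝔬 X|`. -/
def IsRandomModuleLaw {S : Set Nat.Primes} {H : Subgroup G} {O : ZSub S (MonoidAlgebra ℚ G)}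
    {hO : IsOrder S 1 O} (v : Comp (augIdem H) → ℂ)
    (P : PMF (FinModClass (heckeRing H O hO))) : Prop :=
  ∀ X Y : FinMod (heckeRing H O hO),
    P ⟦X⟧ * ENNReal.ofReal
        (cardPow v X * Nat.card (X.carrier ≃ₗ[heckeRing H O hO] X.carrier)) =
      P ⟦Y⟧ * ENNReal.ofReal
        (cardPow v Y * Nat.card (Y.carrier ≃ₗ[heckeRing H O hO] Y.carrier))

/-! ### Comparison of two groups -/

variable {E : Type*} [Group E] [Fintype E]

/-- For a surjection `π : E → G` with kernel `Δ`, the linear map `ℚ[G] → ℚ[E]` sending `γ` to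
`∑_{π(σ) = γ} σ = σ ∑_{δ ∈ Δ} δ` (for any `σ` over `γ`). -/
def cosetSum (π : E →* G) : MonoidAlgebra ℚ G →ₗ[ℚ] MonoidAlgebra ℚ E where
  toFun x := ∑ s : E, MonoidAlgebra.single s (x.coeff (π s))
  map_add' x y := by simp [MonoidAlgebra.single_add, Finset.sum_add_distrib]
  map_smul' c x := by simp [Finset.smul_sum, MonoidAlgebra.smul_single]

theorem coeff_cosetSum (π : E →* G) (x : MonoidAlgebra ℚ G) (s : E) :
    (cosetSum π x).coeff s = x.coeff (π s) := by
  classical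
  change (∑ s : E, MonoidAlgebra.single s (x.coeff (π s))).coeff s = x.coeff (π s)
  simp [Finsupp.single_apply, Finsupp.finsetSum_apply]

theorem sum_comp_surjective (π : E →* G) (hπ : Function.Surjective π) (f : G → ℚ) :
    ∑ s : E, f (π s) = Nat.card π.ker * ∑ g : G, f g := by
  classical
  have key : ∀ g : G, (Finset.univ.filter fun s : E => π s = g).card = Nat.card π.ker := by
    intro g
    rw [MonoidHom.card_fiber_eq_of_mem_range π (hπ g) (hπ 1), Nat.card_eq_fintype_card,
      Fintype.card_subtype]
    exact congrArg Finset.card (Finset.filter_congr fun s _ => π.mem_ker.symm)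
  rw [← Finset.sum_fiberwise Finset.univ π, Finset.mul_sum]
  refine Finset.sum_congr rfl fun g _ => ?_
  rw [Finset.sum_congr rfl (g := fun _ => f g) fun s hs => by rw [(Finset.mem_filter.mp hs).2],
    Finset.sum_const, key, nsmul_eq_mul]

theorem cosetSum_mul (π : E →* G) (hπ : Function.Surjective π) (x y : MonoidAlgebra ℚ G) :
    cosetSum π x * cosetSum π y = (Nat.card π.ker : ℚ) • cosetSum π (x * y) := by
  classical
  ext s
  have h : ∀ (F : Type _) [Group F] [Fintype F] (a b : MonoidAlgebra ℚ F) (s : F),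
      (a * b).coeff s = ∑ t : F, a.coeff t * b.coeff (t⁻¹ * s) := by
    intro F _ _ a b s
    rw [MonoidAlgebra.coeff_mul_apply_left, Finsupp.sum_fintype _ _ (by simp)]
  have h' : ∀ (a b : MonoidAlgebra ℚ E) (s : E),
      (a * b).coeff s = ∑ t : E, a.coeff t * b.coeff (t⁻¹ * s) := by
    intro a b s
    rw [MonoidAlgebra.coeff_mul_apply_left, Finsupp.sum_fintype _ _ (by simp)]
  rw [h', MonoidAlgebra.coeff_smul, Finsupp.smul_apply, coeff_cosetSum, h]
  simp only [coeff_cosetSum, map_mul, map_inv, smul_eq_mul]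
  exact sum_comp_surjective π hπ fun t => x.coeff t * y.coeff (t⁻¹ * π s)

/-- For a surjection `π : E → G` with kernel `Δ`, the (non-unital) algebra embedding
`ℚ[G] → ℚ[E]`, `γ ↦ |Δ|⁻¹ σ ∑_{δ ∈ Δ} δ` where `π(σ) = γ`. It is an isomorphism onto `F₁ ℚ[E]`,
`F₁ = |Δ|⁻¹ ∑_{δ ∈ Δ} δ`. -/
def inflation (π : E →* G) (hπ : Function.Surjective π) :
    MonoidAlgebra ℚ G →ₙₐ[ℚ] MonoidAlgebra ℚ E where
  toFun x := (Nat.card π.ker : ℚ)⁻¹ • cosetSum π x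
  map_zero' := by simp
  map_add' x y := by simp
  map_smul' c x := by
    rw [map_smul]
    exact smul_comm _ _ _
  map_mul' x y := by
    have h0 : (Nat.card π.ker : ℚ) ≠ 0 := by exact_mod_cast Nat.card_pos.ne'
    rw [smul_mul_smul_comm, cosetSum_mul π hπ, smul_smul, mul_assoc, inv_mul_cancel₀ h0, mul_one]

section Restriction

variable {K₀ L M : Type*} [Field K₀] [Field L] [Field M] [Algebra K₀ L] [Algebra K₀ M]
  [Algebra L M] [IsScalarTower K₀ L M] [Normal K₀ L] {Γ Ξ : Type*} [Group Γ] [Group Ξ]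

/-- The surjection `Ξ → Γ` corresponding to the restriction map `Gal(M/K₀) → Gal(L/K₀)`. -/
def restrictHom (τL : Gal(L/K₀) ≃* Γ) (τM : Gal(M/K₀) ≃* Ξ) : Ξ →* Γ :=
  τL.toMonoidHom.comp ((AlgEquiv.restrictNormalHom L).comp τM.symm.toMonoidHom)

theorem restrictHom_surjective [Normal K₀ M] (τL : Gal(L/K₀) ≃* Γ) (τM : Gal(M/K₀) ≃* Ξ) :
    Function.Surjective (restrictHom τL τM) :=
  τL.surjective.comp ((AlgEquiv.restrictNormalHom_surjective M).comp τM.symm.surjective)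

end Restriction

end Group

end CohenMartinet

end

open CohenMartinet

/-!
Inflation `F` has the ring homomorphism `ℚ[Σ] → ℚ[Γ]` extending `π` (deflation) as a left inverse,
and satisfies the projection formula `F x * y = F (x * deflation y)`. Hence `F` identifies `ℚ[Γ]`
with the ideal `F 1 * ℚ[Σ]`, and irreducible central idempotents with those below `F 1`. As
`Σ' = π⁻¹(Γ')`, a central element of `ℚ[Σ]` and its deflation act on the augmentation kernels of
`ℚ[Σ/Σ']` and `ℚ[Γ/Γ']` in the same way, so `F e_{Γ/Γ'} = e_{Σ/Σ'}`.

An absolutely irreducible character belonging to `F ε` is inflated from one belonging to `ε`. Every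
inner product in the rank is a combination of traces of the averages of subgroups, which are
idempotents; on an absolutely irreducible representation `V` belonging to `ε` an idempotent `f` has
trace `dim (ε f A) / dim V`, where `A = ℚ[Γ]` and the dimension is over the center of `ε A`, and
`dim V` is the square root of that of `ε A`. So these traces do not depend on the chosen character.
Moreover `π` maps decomposition groups onto conjugates of decomposition groups.

For the orders, a nonzero idempotent cannot have all its coefficients divisible by `p`. As the
coefficients of `F e` are those of `e` divided by `|Δ|`, integrality of `F e` makes `|Δ|` a unit in
`ℤ_S`. Then the deflation of `O'` is an order containing `O`, hence equal to `O`, and the projection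
formula gives `F e * O' = F (e O)`.

Finally, the conditions `P(X) w(X) = P(Y) w(Y)` and `∑ P = 1` determine a law `P` by the weights
`w`, and the weights are preserved by `θ`.
-/

noncomputable section

namespace CohenMartinet

section CentralSimple

open scoped TensorProduct

variable {Z A : Type*} [Field Z] [Ring A] [Algebra Z A]

theorem isSimpleModule_range_mulLeftRight [IsSimpleRing A] :
    IsSimpleModule (AlgHom.mulLeftRight Z A).range A := by
  have smul_eq (a : A) (b : Aᵐᵒᵖ) (x : A) :
      (AlgHom.mulLeftRight Z A).rangeRestrict (a ⊗ₜ b) • x = a * x * b.unop :=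
    AlgHom.mulLeftRight_apply Z A a b x
  rw [isSimpleModule_iff]
  refine { eq_bot_or_eq_top := fun N => ?_ }
  have mul_mul_mem (a b : A) {x : A} (hx : x ∈ N) : a * x * b ∈ N :=
    smul_eq a (.op b) x ▸ N.smul_mem _ hx
  let I : Ideal A :=
    { N.toAddSubmonoid with smul_mem' := fun a x hx => by simpa using mul_mul_mem a 1 hx }
  have hI : I.IsTwoSided := ⟨fun b hx => show _ ∈ N by simpa using mul_mul_mem 1 b hx⟩
  refine ((isSimpleRing_iff_isTwoSided_imp.mp ‹IsSimpleRing A›).2 I hI).imp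
    (fun h => ?_) fun h => ?_
  all_goals exact SetLike.ext fun x => SetLike.ext_iff.mp h x

theorem exists_eq_smul_of_end_range_mulLeftRight [Algebra.IsCentral Z A]
    (f : Module.End (AlgHom.mulLeftRight Z A).range A) : ∃ z : Z, ∀ x, f x = z • x := by
  have map_mul_mul (a b x : A) : f (a * x * b) = a * f x * b := by
    have h := f.map_smul ((AlgHom.mulLeftRight Z A).rangeRestrict (a ⊗ₜ .op b)) x
    simpa [Subalgebra.smul_def] using h
  have hleft (x : A) : f x = f 1 * x := by simpa using map_mul_mul 1 x 1
  have hright (x : A) : f x = x * f 1 := by simpa using map_mul_mul x 1 1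
  obtain ⟨z, hz⟩ := Algebra.IsCentral.mem_center_iff (K := Z) |>.mp
    (Subalgebra.mem_center_iff.mpr fun x => (hright x).symm.trans (hleft x))
  exact ⟨z, fun x => by rw [hleft, hz, Algebra.smul_def]⟩

theorem mulLeftRight_surjective [Algebra.IsCentral Z A] [IsSimpleRing A] [FiniteDimensional Z A] :
    Function.Surjective (AlgHom.mulLeftRight Z A) := by
  classical
  have := isSimpleModule_range_mulLeftRight (Z := Z) (A := A)
  intro T
  let T' : Module.End (Module.End (AlgHom.mulLeftRight Z A).range A) A :=
    { toFun := T
      map_add' := T.map_add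
      map_smul' := fun f x => by
        obtain ⟨z, hz⟩ := exists_eq_smul_of_end_range_mulLeftRight f
        simp [hz] }
  let b := Module.finBasis Z A
  obtain ⟨⟨_, t, rfl⟩, ht⟩ := jacobson_density (R := (AlgHom.mulLeftRight Z A).range)
    T' (Finset.univ.image b)
  exact ⟨t, b.ext fun i => (ht (b i) (by simp)).symm⟩

section Span

variable {C B : Type*} [Field C] [Ring B] [Algebra C B]

theorem exists_algebraMap_eq_of_commute [Algebra.IsCentral C B] {X : Set B}
    (hX : Submodule.span C X = ⊤) {b : B} (hb : ∀ x ∈ X, x * b = b * x) :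
    ∃ c : C, algebraMap C B c = b := by
  have hcenter : b ∈ Subalgebra.center C B := Subalgebra.mem_center_iff.mpr fun y => by
    have hy : y ∈ Submodule.span C X := hX ▸ Submodule.mem_top
    induction hy using Submodule.span_induction with
    | mem y hy => exact hb y hy
    | zero => simp
    | add y y' _ _ h h' => rw [add_mul, mul_add, h, h']
    | smul c y _ h => rw [smul_mul_assoc, mul_smul_comm, h]
  obtain ⟨c, hc⟩ := Algebra.IsCentral.mem_center_iff (K := C) |>.mp hcenter
  exact ⟨c, hc.symm⟩

theorem exists_ringHom_algebraMap_eq [Algebra.IsCentral C B] [Nontrivial B] (s : A →+* B)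
    (hs : Submodule.span C (Set.range s) = ⊤) :
    ∃ ζ : Z →+* C, ∀ z, s (algebraMap Z A z) = algebraMap C B (ζ z) := by
  have h (z : Z) : ∃ c : C, algebraMap C B c = s (algebraMap Z A z) :=
    exists_algebraMap_eq_of_commute hs <| Set.forall_mem_range.mpr fun a => by
      rw [← map_mul, ← map_mul, Algebra.commutes]
  choose ζ hζ using h
  have inj := FaithfulSMul.algebraMap_injective C B
  exact ⟨{ toFun := ζ
           map_one' := inj (by simp [hζ])
           map_mul' := fun x y => inj (by simp [hζ])
           map_zero' := inj (by simp [hζ])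
           map_add' := fun x y => inj (by simp [hζ]) }, fun z => (hζ z).symm⟩

variable {ι : Type*} (b : Module.Basis ι Z A) (s : A →+* B) {ζ : Z →+* C}

theorem map_eq_sum_repr_smul [Fintype ι]
    (hζ : ∀ z, s (algebraMap Z A z) = algebraMap C B (ζ z)) (a : A) :
    s a = ∑ i, ζ (b.repr a i) • s (b i) := by
  conv_lhs => rw [← b.sum_repr a]
  simp [Algebra.smul_def, hζ]

variable [Finite ι] [Algebra.IsCentral Z A] [IsSimpleRing A] [FiniteDimensional Z A]

theorem linearIndependent_map_basis [Nontrivial B] : LinearIndependent C (s ∘ b) := by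
  classical
  cases nonempty_fintype ι
  rw [Fintype.linearIndependent_iff]
  intro c hc i
  -- Since `t ↦ t • x` is surjective onto the endomorphisms, a relation persists under every
  -- linear substitution of the basis, in particular under `b j ↦ δᵢⱼ`.
  have persists (t : A ⊗[Z] Aᵐᵒᵖ) : ∑ j, c j • s (AlgHom.mulLeftRight Z A t (b j)) = 0 := by
    induction t with
    | zero => simp
    | tmul x y =>
      have : ∑ j, c j • s (x * b j * y.unop) = s x * (∑ j, c j • s (b j)) * s y.unop := by
        simp [Finset.mul_sum, Finset.sum_mul]
      simpa [show ∑ j, c j • s (b j) = 0 from hc] using this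
    | add t t' h h' => simp [Finset.sum_add_distrib, h, h']
  obtain ⟨t, ht⟩ := mulLeftRight_surjective (b.constr Z (Pi.single i (1 : A)))
  have h := persists t
  rw [ht, Finset.sum_eq_single i (fun j _ hj => by simp [hj]) (by simp)] at h
  simpa using h

variable (hs : Submodule.span C (Set.range s) = ⊤)
  (hζ : ∀ z, s (algebraMap Z A z) = algebraMap C B (ζ z))

/-- The image of a `Z`-basis of the central simple algebra `A` in a nonzero ring `B` that is
spanned over the larger field `C` by the image of `A`; thus `B` is the scalar extension of `A`. -/
def scalarExtensionBasis [Nontrivial B] : Module.Basis ι C B :=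
  .mk (linearIndependent_map_basis b s) <| by
    rw [← hs, Submodule.span_le]
    rintro _ ⟨a, rfl⟩
    cases nonempty_fintype ι
    rw [map_eq_sum_repr_smul b s hζ]
    exact Submodule.sum_mem _ fun i _ => Submodule.smul_mem _ _ (Submodule.subset_span ⟨i, rfl⟩)

theorem scalarExtensionBasis_apply [Nontrivial B] (i : ι) :
    scalarExtensionBasis b s hs hζ i = s (b i) :=
  Module.Basis.mk_apply _ _ i

theorem scalarExtensionBasis_repr [Nontrivial B] (a : A) (i : ι) :
    (scalarExtensionBasis b s hs hζ).repr (s a) i = ζ (b.repr a i) := by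
  cases nonempty_fintype ι
  rw [show s a = ∑ i, ζ (b.repr a i) • scalarExtensionBasis b s hs hζ i by
    simpa only [scalarExtensionBasis_apply] using map_eq_sum_repr_smul b s hζ a,
    Module.Basis.repr_sum_self]

include hs hζ

theorem finrank_eq_of_span_range_eq_top [Nontrivial B] :
    Module.finrank C B = Module.finrank Z A := by
  rw [Module.finrank_eq_card_basis (scalarExtensionBasis (Module.finBasis Z A) s hs hζ),
    Fintype.card_fin]

theorem trace_mulLeft_map [Nontrivial B] (a : A) :
    LinearMap.trace C B (LinearMap.mulLeft C (s a)) =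
      ζ (LinearMap.trace Z A (LinearMap.mulLeft Z a)) := by
  classical
  let b := Module.finBasis Z A
  rw [LinearMap.trace_eq_matrix_trace C (scalarExtensionBasis b s hs hζ),
    LinearMap.trace_eq_matrix_trace Z b, Matrix.trace, Matrix.trace, map_sum]
  refine Finset.sum_congr rfl fun i _ => ?_
  rw [Matrix.diag_apply, Matrix.diag_apply, LinearMap.toMatrix_apply, LinearMap.toMatrix_apply,
    LinearMap.mulLeft_apply, LinearMap.mulLeft_apply, ← scalarExtensionBasis_repr b s hs hζ,
    scalarExtensionBasis_apply, ← map_mul]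

end Span

theorem trace_mulLeft_end {C V : Type*} [Field C] [AddCommGroup V] [Module C V]
    [FiniteDimensional C V] (T : Module.End C V) :
    LinearMap.trace C (Module.End C V) (LinearMap.mulLeft C T) =
      Module.finrank C V * LinearMap.trace C V T := by
  have conj_eq : (dualTensorHomEquiv C V V).conj (TensorProduct.map LinearMap.id T) =
      LinearMap.mulLeft C T := by
    have comp_eq : LinearMap.mulLeft C T ∘ₗ dualTensorHom C V V =
        dualTensorHom C V V ∘ₗ TensorProduct.map LinearMap.id T := by
      ext x y v
      simp
    ext1 U
    obtain ⟨t, rfl⟩ := (dualTensorHomEquiv C V V).surjective U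
    rw [LinearEquiv.conj_apply_apply, LinearEquiv.symm_apply_apply]
    exact (LinearMap.congr_fun comp_eq t).symm
  rw [← conj_eq, LinearMap.trace_conj' (M := Module.Dual C V ⊗[C] V) (N := Module.End C V),
    LinearMap.trace_tensorProduct',
    LinearMap.trace_id, Subspace.dual_finrank_eq]

theorem trace_mulLeft_of_isIdempotentElem [FiniteDimensional Z A] {f : A}
    (hf : IsIdempotentElem f) : LinearMap.trace Z A (LinearMap.mulLeft Z f) =
      Module.finrank Z (LinearMap.range (LinearMap.mulLeft Z f)) :=
  (LinearMap.IsIdempotentElem.isProj_range _ <| LinearMap.ext fun x => by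
    simp [← mul_assoc, hf.eq]).trace

section Representation

variable [Algebra.IsCentral Z A] [IsSimpleRing A] [FiniteDimensional Z A]
  {C V : Type*} [Field C] [AddCommGroup V] [Module C V] [FiniteDimensional C V] [Nontrivial V]
  {s : A →+* Module.End C V} (hs : Submodule.span C (Set.range s) = ⊤)
include hs

variable (Z) in
theorem finrank_eq_sq_of_span_range_eq_top : Module.finrank Z A = Module.finrank C V ^ 2 := by
  obtain ⟨ζ, hζ⟩ := exists_ringHom_algebraMap_eq (Z := Z) s hs
  rw [← finrank_eq_of_span_range_eq_top s hs hζ, Module.finrank_linearMap, sq]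

variable (Z) in
theorem finrank_mul_trace_eq_of_isIdempotentElem {f : A} (hf : IsIdempotentElem f) :
    (Module.finrank C V : C) * LinearMap.trace C V (s f) =
      Module.finrank Z (LinearMap.range (LinearMap.mulLeft Z f)) := by
  obtain ⟨ζ, hζ⟩ := exists_ringHom_algebraMap_eq (Z := Z) s hs
  rw [← trace_mulLeft_end, trace_mulLeft_map s hs hζ, trace_mulLeft_of_isIdempotentElem hf,
    map_natCast]

end Representation

end CentralSimple

section Corner

variable {R : Type*} [Ring R]

theorem IsCentralIdem.mul_mul_self {e : R} (he : IsCentralIdem e) (x : R) : e * x * e = e * x := by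
  rw [mul_assoc, ← he.2, ← mul_assoc, he.1.eq]

theorem IsCentralIdem.mul_val_corner {e : R} (he : IsCentralIdem e) (a : he.1.Corner) :
    e * a.1 = a.1 := by
  obtain ⟨_, r, rfl⟩ := a
  simp only [← mul_assoc, he.1.eq]

/-- The projection `x ↦ e x` of a ring onto the corner of the central idempotent `e`. -/
def IsCentralIdem.toCorner {e : R} (he : IsCentralIdem e) : R →+* he.1.Corner where
  toFun x := ⟨e * x, x, he.mul_mul_self x⟩
  map_one' := Subtype.ext (mul_one e)
  map_mul' x y := Subtype.ext <| show e * (x * y) = e * x * (e * y) by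
    rw [← mul_assoc (e * x), he.mul_mul_self, mul_assoc]
  map_zero' := Subtype.ext (mul_zero e)
  map_add' x y := Subtype.ext (mul_add e x y)

theorem IsCentralIdem.toCorner_val {e : R} (he : IsCentralIdem e) (a : he.1.Corner) :
    he.toCorner a.1 = a :=
  Subtype.ext (he.mul_val_corner a)

theorem IsCentralIdem.toCorner_surjective {e : R} (he : IsCentralIdem e) :
    Function.Surjective he.toCorner :=
  fun a => ⟨a.1, he.toCorner_val a⟩

theorem exists_isCentralIdem_of_isTwoSided [IsSemisimpleRing R] (I : Ideal R) [I.IsTwoSided] :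
    ∃ f : R, IsCentralIdem f ∧ ∀ x, x ∈ I ↔ f * x = x := by
  -- As a left ideal `I` is generated by an idempotent `f`, as a right ideal by an idempotent `g`;
  -- then `f = g * f = g`.
  obtain ⟨f, hf, hI⟩ := IsSemisimpleRing.ideal_eq_span_idempotent I
  let I' : Ideal Rᵐᵒᵖ :=
    { carrier := {x | x.unop ∈ I}
      add_mem' := I.add_mem
      zero_mem' := I.zero_mem
      smul_mem' := fun r _ hx => I.mul_mem_right r.unop hx }
  obtain ⟨g, hg, hI'⟩ := IsSemisimpleRing.ideal_eq_span_idempotent I'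
  have hfI : f ∈ I := hI ▸ Ideal.mem_span_singleton_self f
  have hgI : g ∈ I' := hI' ▸ Ideal.mem_span_singleton_self g
  have mul_right {x : R} (hx : x ∈ I) : x * f = x := by
    obtain ⟨a, rfl⟩ := Ideal.mem_span_singleton'.mp (hI ▸ hx)
    rw [mul_assoc, hf.eq]
  have mul_left {x : R} (hx : x ∈ I) : g.unop * x = x := by
    obtain ⟨a, ha⟩ := Ideal.mem_span_singleton'.mp (hI' ▸ (show MulOpposite.op x ∈ I' from hx))
    rw [← MulOpposite.unop_op x, ← ha, ← MulOpposite.unop_mul, mul_assoc, hg.eq]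
  have hgf : g.unop = f := (mul_right hgI).symm.trans (mul_left hfI)
  rw [hgf] at mul_left
  refine ⟨f, ⟨hf, fun x => ?_⟩, fun x => ⟨mul_left, fun h => h ▸ I.mul_mem_right x hfI⟩⟩
  rw [← mul_right (I.mul_mem_right x hfI), mul_assoc, mul_left (I.mul_mem_left x hfI)]

theorem IsIrredCentralIdem.isSimpleRing_corner [IsSemisimpleRing R] {ε : R}
    (hε : IsIrredCentralIdem ε) : IsSimpleRing hε.1.1.Corner := by
  rw [isSimpleRing_iff_isTwoSided_imp]
  refine ⟨⟨⟨0, 1, fun h => hε.2.1 (congrArg Subtype.val h).symm⟩⟩, fun I _ => ?_⟩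
  obtain ⟨f, hf, mem_comap⟩ := exists_isCentralIdem_of_isTwoSided (I.comap hε.1.toCorner)
  simp only [Ideal.mem_comap] at mem_comap
  rcases hε.2.2 f hf with h | h
  · refine .inl (eq_bot_iff.mpr fun a ha => Subtype.ext (?_ : a.1 = 0))
    have hfa : f * a.1 = a.1 := (mem_comap _).mp ((hε.1.toCorner_val a).symm ▸ ha)
    rw [← hε.1.mul_val_corner a, ← hfa, ← mul_assoc, h, zero_mul]
  · refine .inr ((Ideal.eq_top_iff_one I).mpr ?_)
    rw [← hε.1.toCorner_val 1]
    exact (mem_comap ε).mpr (hε.1.2 f ▸ h)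

theorem finite_center_of_surjective {K A : Type*} [Field K] [Algebra K R] [Module.Finite K R]
    [Ring A] (f : R →+* A) (hf : Function.Surjective f) : Module.Finite (Subring.center A) A := by
  let z : K →+* Subring.center A := (f.comp (algebraMap K R)).codRestrict _ fun c => by
    refine Subring.mem_center_iff.mpr fun a => ?_
    obtain ⟨r, rfl⟩ := hf a
    rw [RingHom.comp_apply, ← map_mul, ← map_mul, Algebra.commutes]
  let := z.toAlgebra
  let := Module.compHom A z
  have : IsScalarTower K (Subring.center A) A := ⟨fun c x a => mul_assoc (z c : A) x a⟩
  let f' : R →ₗ[K] A :=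
    { f with
      map_smul' := fun c r => (congrArg f (Algebra.smul_def c r)).trans (map_mul f _ r) }
  have : Module.Finite K A := Module.Finite.of_surjective f' hf
  exact Module.Finite.of_restrictScalars_finite K (Subring.center A) A

instance (A : Type*) [Ring A] : Algebra.IsCentral (Subring.center A) A :=
  ⟨fun x hx => ⟨⟨x, Subring.mem_center_iff.mpr (Subalgebra.mem_center_iff.mp hx)⟩, rfl⟩⟩

/-- The dimension over the center of `ε R` of the right ideal `ε f R`. -/
def cornerRank {ε : R} (hε : IsIrredCentralIdem ε) (f : R) : ℕ :=
  Module.finrank (Subring.center hε.1.1.Corner) (LinearMap.range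
    (LinearMap.mulLeft (Subring.center hε.1.1.Corner) (hε.1.toCorner f)))

variable {C V : Type*} [Field C] [AddCommGroup V] [Module C V]

/-- The action `s` of `R` on `V` is absolutely irreducible, in the sense that its operators span all
endomorphisms, and the central idempotent `ε` acts as the identity. -/
structure BelongsTo (s : R →+* Module.End C V) (ε : R) : Prop where
  span_range_eq_top : Submodule.span C (Set.range s) = ⊤
  map_eq_one : s ε = 1

namespace BelongsTo

variable {s : R →+* Module.End C V} {ε : R} (h : BelongsTo s ε) (hε : IsIrredCentralIdem ε)

/-- The action of the corner `ε R` through which an action belonging to `ε` factors. -/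
def cornerHom : hε.1.1.Corner →+* Module.End C V where
  toFun a := s a.1
  map_one' := h.map_eq_one
  map_mul' a b := s.map_mul a.1 b.1
  map_zero' := s.map_zero
  map_add' a b := s.map_add a.1 b.1

theorem cornerHom_toCorner (x : R) : h.cornerHom hε (hε.1.toCorner x) = s x :=
  (s.map_mul ε x).trans (by rw [h.map_eq_one, one_mul])

theorem span_range_cornerHom : Submodule.span C (Set.range (h.cornerHom hε)) = ⊤ := by
  rw [eq_top_iff, ← h.span_range_eq_top, Submodule.span_le]
  rintro _ ⟨x, rfl⟩
  exact Submodule.subset_span ⟨_, h.cornerHom_toCorner hε x⟩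

variable [FiniteDimensional C V] [Nontrivial V] [IsSemisimpleRing R]
  [Module.Finite (Subring.center hε.1.1.Corner) hε.1.1.Corner]
include h

theorem finrank_corner_eq_sq :
    Module.finrank (Subring.center hε.1.1.Corner) hε.1.1.Corner = Module.finrank C V ^ 2 := by
  have := hε.isSimpleRing_corner
  let := (IsSimpleRing.isField_center hε.1.1.Corner).toField
  exact finrank_eq_sq_of_span_range_eq_top _ (h.span_range_cornerHom hε)

theorem hdim_eq_finrank : hdim ε hε = Module.finrank C V := by
  rw [hdim, h.finrank_corner_eq_sq hε, Nat.sqrt_eq']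

theorem hdim_mul_trace {f : R} (hf : IsIdempotentElem f) :
    (hdim ε hε : C) * LinearMap.trace C V (s f) = cornerRank hε f := by
  have := hε.isSimpleRing_corner
  let := (IsSimpleRing.isField_center hε.1.1.Corner).toField
  rw [h.hdim_eq_finrank hε, ← h.cornerHom_toCorner hε]
  exact finrank_mul_trace_eq_of_isIdempotentElem _ (h.span_range_cornerHom hε)
    (hf.map hε.1.toCorner)

include hε in
theorem trace_eq [CharZero C] {V' : Type*} [AddCommGroup V'] [Module C V'] [FiniteDimensional C V']
    [Nontrivial V'] {s' : R →+* Module.End C V'} (h' : BelongsTo s' ε) {f : R}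
    (hf : IsIdempotentElem f) : LinearMap.trace C V (s f) = LinearMap.trace C V' (s' f) := by
  have hdim_ne_zero : (hdim ε hε : C) ≠ 0 := by
    rw [h.hdim_eq_finrank hε]
    exact_mod_cast Module.finrank_pos.ne'
  exact mul_left_cancel₀ hdim_ne_zero
    ((h.hdim_mul_trace hε hf).trans (h'.hdim_mul_trace hε hf).symm)

end BelongsTo

end Corner

section InnerProduct

variable {X : Type*} [Fintype X]

theorem cinner_comm (a b : X → ℂ) : cinner a b = (starRingEnd ℂ) (cinner b a) := by
  simp [cinner, mul_comm]

theorem cinner_sub_right (a b c : X → ℂ) : cinner a (b - c) = cinner a b - cinner a c := by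
  simp [cinner, mul_sub, Finset.sum_sub_distrib]

theorem cinner_sum_right {ι : Type*} (s : Finset ι) (a : X → ℂ) (b : ι → X → ℂ) :
    cinner a (∑ i ∈ s, b i) = ∑ i ∈ s, cinner a (b i) := by
  simp only [cinner, Finset.sum_apply, map_sum, Finset.mul_sum]
  exact Finset.sum_comm

end InnerProduct

section InducedCharacter

variable {G : Type*} [Group G]

theorem indUnit_map_conj (H : Subgroup G) (g : G) :
    indUnit (H.map (MulAut.conj g).toMonoidHom) = indUnit H := by
  funext y
  rw [indUnit, indUnit, Nat.card_congr
    (H.equivMapOfInjective (MulAut.conj g).toMonoidHom (MulAut.conj g).injective).toEquiv.symm]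
  congr 2
  refine Nat.card_congr (Equiv.subtypeEquiv (Equiv.mulRight g) fun x => ?_)
  rw [Subgroup.mem_map_equiv, MulAut.conj_symm_apply]
  simp [mul_assoc]

theorem indUnit_top [Finite G] (g : G) : indUnit (⊤ : Subgroup G) g = 1 := by
  simp [indUnit]

theorem augChar_eq [Finite G] (H : Subgroup G) : augChar H = indUnit H - indUnit ⊤ :=
  funext fun g => by rw [augChar, Pi.sub_apply, indUnit_top]

variable [Fintype G]

theorem indUnit_eq_sum_indicator (H : Subgroup G) (g : G) :
    indUnit H g = (Nat.card H : ℂ)⁻¹ * ∑ x : G, (H : Set G).indicator 1 (x⁻¹ * g * x) := by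
  classical
  simp [indUnit, Set.indicator_apply, Nat.card_eq_fintype_card, Fintype.card_subtype]

theorem cinner_indUnit {χ : G → ℂ} (hχ : ∀ g x, χ (x * g * x⁻¹) = χ g) (H : Subgroup G)
    [Fintype H] : cinner χ (indUnit H) = (Nat.card H : ℂ)⁻¹ * ∑ h : H, χ h := by
  classical
  have conj_indicator (x : G) :
      ∑ g, χ g * (H : Set G).indicator 1 (x⁻¹ * g * x) = ∑ h : H, χ h := by
    rw [← (MulAut.conj x).toEquiv.sum_comp,
      ← Finset.sum_subtype (Finset.univ.filter (· ∈ H)) (by simp) χ, Finset.sum_filter]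
    refine Finset.sum_congr rfl fun g _ => ?_
    simp [Set.indicator_apply, hχ, show x⁻¹ * (x * g * x⁻¹) * x = g by group]
  have star_indUnit (g : G) : starRingEnd ℂ (indUnit H g) = indUnit H g := by simp [indUnit]
  have card_ne_zero : (Nat.card G : ℂ) ≠ 0 := by exact_mod_cast Nat.card_pos.ne'
  calc cinner χ (indUnit H)
      = (Nat.card G : ℂ)⁻¹ * ((Nat.card H : ℂ)⁻¹ *
          ∑ x, ∑ g, χ g * (H : Set G).indicator 1 (x⁻¹ * g * x)) := by
        simp only [cinner, star_indUnit]
        rw [Finset.sum_comm]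
        simp only [indUnit_eq_sum_indicator, Finset.mul_sum, mul_left_comm (χ _)]
    _ = (Nat.card H : ℂ)⁻¹ * ∑ h : H, χ h := by
        simp only [conj_indicator, Finset.sum_const, Finset.card_univ, ← Nat.card_eq_fintype_card,
          nsmul_eq_mul]
        field_simp

end InducedCharacter

section Involution

variable {G : Type*} [Group G]

theorem coeff_antipode (x : MonoidAlgebra ℚ G) (g : G) :
    (HopfAlgebra.antipode ℚ x).coeff g = x.coeff g⁻¹ := by
  classical
  induction x using MonoidAlgebra.induction_linear with
  | zero => simp
  | add x y hx hy => simp [hx, hy]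
  | single h a => simp [MonoidAlgebra.antipode_single, Finsupp.single_apply, inv_eq_iff_eq_inv]

theorem antipode_antipode (x : MonoidAlgebra ℚ G) :
    HopfAlgebra.antipode ℚ (HopfAlgebra.antipode ℚ x) = x := by
  ext g
  simp only [coeff_antipode, inv_inv]

theorem IsCentralIdem.antipode {ε : MonoidAlgebra ℚ G} (h : IsCentralIdem ε) :
    IsCentralIdem (HopfAlgebra.antipode ℚ ε) := by
  refine ⟨?_, fun x => ?_⟩
  · rw [IsIdempotentElem, ← HopfAlgebra.antipode_mul_antidistrib, h.1.eq]
  · rw [← antipode_antipode x, ← HopfAlgebra.antipode_mul_antidistrib,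
      ← HopfAlgebra.antipode_mul_antidistrib, h.2]

theorem coeff_mul_eq_sum [Fintype G] {k : Type*} [Semiring k] (x y : MonoidAlgebra k G) (g : G) :
    (x * y).coeff g = ∑ t : G, x.coeff t * y.coeff (t⁻¹ * g) := by
  rw [MonoidAlgebra.coeff_mul_apply_left, Finsupp.sum_fintype _ _ (by simp)]

variable [Finite G]

theorem mul_antipode_ne_zero {x : MonoidAlgebra ℚ G} (hx : x ≠ 0) :
    x * HopfAlgebra.antipode ℚ x ≠ 0 := by
  cases nonempty_fintype G
  contrapose! hx
  have coeff_one : ∑ t : G, x.coeff t * x.coeff t = 0 := by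
    simpa [coeff_mul_eq_sum, coeff_antipode] using congrArg (fun y => y.coeff 1) hx
  ext g
  simpa using (Finset.sum_eq_zero_iff_of_nonneg fun t _ => mul_self_nonneg (x.coeff t)).mp
    coeff_one g (Finset.mem_univ g)

theorem IsIrredCentralIdem.antipode_eq {ε : MonoidAlgebra ℚ G} (hε : IsIrredCentralIdem ε) :
    HopfAlgebra.antipode ℚ ε = ε := by
  have h : ε * HopfAlgebra.antipode ℚ ε = ε :=
    (hε.2.2 _ hε.1.antipode).resolve_left (mul_antipode_ne_zero hε.2.1)
  conv_lhs => rw [← h, HopfAlgebra.antipode_mul_antidistrib, antipode_antipode, h]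

end Involution

section Representations

variable {G : Type*} [Group G]

theorem span_range_eq_top_of_isIrreducible {C V : Type*} [Field C] [IsAlgClosed C]
    [AddCommGroup V] [Module C V] [FiniteDimensional C V] (σ : Representation C G V)
    [σ.IsIrreducible] : Submodule.span C (Set.range σ) = ⊤ := by
  classical
  refine eq_top_iff.mpr fun T _ => ?_
  have : FiniteDimensional C σ.asModule := inferInstanceAs (FiniteDimensional C V)
  -- Schur's lemma makes every linear operator commute with the `C[G]`-endomorphisms, so the
  -- density theorem applies to it.
  let T' : Module.End (Module.End (MonoidAlgebra C G) σ.asModule) σ.asModule :=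
    { σ.asModuleEquiv.symm.toLinearMap ∘ₗ T ∘ₗ σ.asModuleEquiv.toLinearMap with
      map_smul' := fun φ x => by
        obtain ⟨c, rfl⟩ := (IsSimpleModule.algebraMap_end_bijective_of_isAlgClosed
          (A := MonoidAlgebra C G) (V := σ.asModule) C).2 φ
        exact (σ.asModuleEquiv.symm.toLinearMap ∘ₗ T ∘ₗ σ.asModuleEquiv.toLinearMap).map_smul c x }
  let b := Module.finBasis C σ.asModule
  obtain ⟨r, hr⟩ := jacobson_density (R := MonoidAlgebra C G) T' (Finset.univ.image b)
  have hT : T = σ.asAlgebraHom r := (b.map σ.asModuleEquiv).ext fun i => by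
    rw [Module.Basis.map_apply, ← σ.asModuleEquiv_map_smul, ← hr (b i) (by simp)]
    exact congrArg T (σ.asModuleEquiv.apply_symm_apply _).symm
  rw [hT, σ.asAlgebraHom_def, MonoidAlgebra.lift_apply]
  exact Submodule.sum_mem _ fun g _ => Submodule.smul_mem _ _ (Submodule.subset_span ⟨g, rfl⟩)

section RatHom

variable {C V : Type*} [Field C] [CharZero C] [AddCommGroup V] [Module C V]
  (σ : Representation C G V)

/-- The action of the rational group algebra on a representation over a field of characteristic
zero. -/
def ratHom : MonoidAlgebra ℚ G →+* Module.End C V :=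
  σ.asAlgebraHom.toRingHom.comp (MonoidAlgebra.mapRingHom G (algebraMap ℚ C))

theorem ratHom_single (g : G) (q : ℚ) :
    ratHom σ (MonoidAlgebra.single g q) = (q : C) • σ g := by
  simp [ratHom, MonoidAlgebra.mapRingHom_single]

theorem ratHom_of (g : G) : ratHom σ (MonoidAlgebra.of ℚ G g) = σ g := by
  simp [ratHom_single]

theorem ratHom_smul (q : ℚ) (x : MonoidAlgebra ℚ G) : ratHom σ (q • x) = (q : C) • ratHom σ x := by
  rw [← one_mul x, ← smul_mul_assoc, map_mul, MonoidAlgebra.one_def, MonoidAlgebra.smul_single,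
    smul_eq_mul, mul_one, ratHom_single, map_one, ← MonoidAlgebra.one_def, one_mul, smul_mul_assoc,
    one_mul]

theorem ratHom_eq_sum [Fintype G] (x : MonoidAlgebra ℚ G) :
    ratHom σ x = ∑ g, (x.coeff g : C) • σ g := by
  conv_lhs => rw [← x.sum_coeff_single, Finsupp.sum_fintype _ _ (by simp), map_sum]
  simp only [ratHom_single]

open Classical in
theorem ratHom_avg [Fintype G] (H : Subgroup G) :
    ratHom σ (avg H) = (Nat.card H : C)⁻¹ • ∑ h : H, σ h := by
  rw [avg, ratHom_smul, map_sum]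
  simp only [ratHom_of, Rat.cast_inv, Rat.cast_natCast]

theorem span_range_ratHom [FiniteDimensional C V] [IsAlgClosed C] [σ.IsIrreducible] :
    Submodule.span C (Set.range (ratHom σ)) = ⊤ := by
  rw [eq_top_iff, ← span_range_eq_top_of_isIrreducible σ]
  refine Submodule.span_mono ?_
  rintro _ ⟨g, rfl⟩
  exact ⟨_, ratHom_of σ g⟩

end RatHom

instance [Finite G] : FiniteDimensional ℚ (MonoidAlgebra ℚ G) :=
  Module.Finite.equiv (MonoidAlgebra.coeffLinearEquiv ℚ (S := ℚ) (M := G)).symm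

variable [Fintype G]

theorem cinner_character_indUnit {V : Type*} [AddCommGroup V] [Module ℂ V]
    [FiniteDimensional ℂ V] (σ : Representation ℂ G V) (H : Subgroup G) :
    cinner σ.character (indUnit H) = LinearMap.trace ℂ V (ratHom σ (avg H)) := by
  classical
  rw [cinner_indUnit fun g x => σ.char_conj g x, ratHom_avg, map_smul, map_sum, smul_eq_mul]
  rfl

/-- The element `∑ g, χ(g) g` of the group algebra attached to the character `χ` of `ρ`. -/
def characterSum {k W : Type*} [Field k] [AddCommGroup W] [Module k W]
    (ρ : Representation k G W) : MonoidAlgebra k G :=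
  ∑ g, MonoidAlgebra.single g (ρ.character g)

theorem coeff_characterSum {k W : Type*} [Field k] [AddCommGroup W] [Module k W]
    (ρ : Representation k G W) (g : G) : (characterSum ρ).coeff g = ρ.character g := by
  classical
  simp [characterSum, Finsupp.single_apply]

theorem characterSum_mul_antipode {W : Type*} [AddCommGroup W] [Module ℚ W]
    (ρ : Representation ℚ G W) {x : MonoidAlgebra ℚ G} (hx : ρ.asAlgebraHom x = 1) :
    characterSum ρ * HopfAlgebra.antipode ℚ x = characterSum ρ := by
  ext g
  have hg : ρ g = ∑ h, x.coeff h • ρ (g * h) := by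
    conv_lhs => rw [← mul_one (ρ g), ← hx, ρ.asAlgebraHom_def, MonoidAlgebra.lift_apply,
      Finsupp.sum_fintype _ _ (by simp), Finset.mul_sum]
    simp only [mul_smul_comm, map_mul]
  rw [coeff_mul_eq_sum, coeff_characterSum, Representation.character, hg, map_sum,
    ← Equiv.sum_comp (Equiv.mulLeft g)]
  simp [coeff_characterSum, coeff_antipode, Representation.character, mul_comm]

theorem cinner_character_character {V W : Type*} [AddCommGroup V] [Module ℂ V]
    [AddCommGroup W] [Module ℚ W] (σ : Representation ℂ G V) (ρ : Representation ℚ G W) :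
    cinner σ.character (fun g => ((ρ.character g : ℚ) : ℂ)) =
      (Nat.card G : ℂ)⁻¹ * LinearMap.trace ℂ V (ratHom σ (characterSum ρ)) := by
  simp [cinner, ratHom_eq_sum, coeff_characterSum, Representation.character, mul_comm]

theorem cinner_eq_zero_of_ratHom_eq_zero {V W : Type*} [AddCommGroup V] [Module ℂ V]
    [AddCommGroup W] [Module ℚ W] (σ : Representation ℂ G V) (ρ : Representation ℚ G W)
    {ε : MonoidAlgebra ℚ G} (hε : IsIrredCentralIdem ε)
    (hρ : ρ.asAlgebraHom ε = 1) (hσ : ratHom σ ε = 0) :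
    cinner σ.character (fun g => ((ρ.character g : ℚ) : ℂ)) = 0 := by
  rw [cinner_character_character, ← characterSum_mul_antipode ρ hρ, hε.antipode_eq, map_mul, hσ,
    mul_zero, map_zero, mul_zero]

theorem IsAbsIrrCharIn.exists_belongsTo {ε : MonoidAlgebra ℚ G} (hε : IsIrredCentralIdem ε)
    {φ : G → ℂ} (h : IsAbsIrrCharIn ε φ) :
    ∃ (m : ℕ) (σ : Representation ℂ G (Fin m → ℂ)),
      m ≠ 0 ∧ BelongsTo (ratHom σ) ε ∧ φ = σ.character := by
  obtain ⟨n, ρ, m, σ, -, hρε, hσ, hφ, hne⟩ := h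
  obtain rfl : φ = σ.character := funext hφ
  have hspan := span_range_ratHom σ
  have hm : m ≠ 0 := by
    rintro rfl
    exact hne (by simp [cinner, Representation.character,
      Subsingleton.elim _ (0 : Module.End ℂ (Fin 0 → ℂ))])
  have : NeZero m := ⟨hm⟩
  obtain ⟨c, hc⟩ := exists_algebraMap_eq_of_commute hspan (b := ratHom σ ε) <|
    Set.forall_mem_range.mpr fun x => by rw [← map_mul, ← map_mul, hε.1.2]
  have hcc : c * c = c := FaithfulSMul.algebraMap_injective ℂ (Module.End ℂ (Fin m → ℂ)) <| by
    rw [map_mul, hc, ← map_mul, hε.1.1.eq]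
  refine ⟨m, σ, hm, ⟨hspan, ?_⟩, rfl⟩
  rcases IsIdempotentElem.iff_eq_zero_or_one.mp hcc with rfl | rfl
  · rw [map_zero] at hc
    exact absurd (cinner_eq_zero_of_ratHom_eq_zero σ ρ hε hρε hc.symm) hne
  · rw [← hc, map_one]

end Representations

section Averages

variable {G : Type*} [Group G] [Fintype G]

theorem coeff_avg (H : Subgroup G) (g : G) : open Classical in
    (avg H).coeff g = if g ∈ H then (Nat.card H : ℚ)⁻¹ else 0 := by
  classical
  simp only [avg, MonoidAlgebra.coeff_smul, MonoidAlgebra.coeff_sum, Finsupp.smul_apply,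
    Finsupp.finsetSum_apply, MonoidAlgebra.of_apply, MonoidAlgebra.coeff_single,
    Finsupp.single_apply, smul_eq_mul]
  rw [← Finset.sum_subtype (Finset.univ.filter (· ∈ H)) (by simp) fun x =>
    if x = g then (1 : ℚ) else 0]
  simp

theorem avg_mul_of (H : Subgroup G) {h : G} (hh : h ∈ H) :
    avg H * MonoidAlgebra.of ℚ G h = avg H := by
  classical
  ext g
  rw [MonoidAlgebra.of_apply, MonoidAlgebra.coeff_mul_single_apply, coeff_avg, coeff_avg, mul_one]
  simp [H.mul_mem_cancel_right (H.inv_mem hh)]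

theorem avg_mul_avg_of_le {H K : Subgroup G} (h : H ≤ K) : avg H * avg K = avg K :=
  avg_mul_of_leftInv H fun _ hτ => of_mul_avg K (h hτ)

theorem mul_avg_of_forall_mul_of {H : Subgroup G} {x : MonoidAlgebra ℚ G}
    (hx : ∀ h ∈ H, x * MonoidAlgebra.of ℚ G h = x) : x * avg H = x := by
  classical
  have card_ne_zero : (Nat.card H : ℚ) ≠ 0 := by exact_mod_cast Nat.card_pos.ne'
  rw [avg, mul_smul_comm, Finset.mul_sum, Finset.sum_congr rfl fun h _ => hx (h : H) h.2,
    Finset.sum_const, Finset.card_univ, ← Nat.card_eq_fintype_card, ← Nat.cast_smul_eq_nsmul ℚ,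
    inv_smul_smul₀ card_ne_zero]

theorem avg_mul_avg_of_ge {H K : Subgroup G} (h : H ≤ K) : avg K * avg H = avg K :=
  mul_avg_of_forall_mul_of fun _ hτ => avg_mul_of K (h hτ)

end Averages

section Augmentation

variable {G : Type*} [Group G]

/-- The projection from `ℚ[G]` to the permutation module `ℚ[G/H]`, given by the action on the
trivial coset. -/
def cosetProj (H : Subgroup G) : MonoidAlgebra ℚ G →ₗ[ℚ] MonoidAlgebra ℚ (G ⧸ H) :=
  LinearMap.applyₗ (MonoidAlgebra.single ((1 : G) : G ⧸ H) 1) ∘ₗ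
    (Representation.ofMulAction ℚ G (G ⧸ H)).asAlgebraHom.toLinearMap

theorem cosetProj_single (H : Subgroup G) (g : G) (q : ℚ) :
    cosetProj H (MonoidAlgebra.single g q) = MonoidAlgebra.single (g : G ⧸ H) q := by
  simp [cosetProj, Representation.asAlgebraHom_single, Representation.ofMulAction_single]

theorem cosetProj_mul (H : Subgroup G) (f x : MonoidAlgebra ℚ G) :
    cosetProj H (f * x) =
      (Representation.ofMulAction ℚ G (G ⧸ H)).asAlgebraHom f (cosetProj H x) := by
  simp [cosetProj]

theorem cosetProj_surjective (H : Subgroup G) : Function.Surjective (cosetProj H) := by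
  intro v
  induction v using MonoidAlgebra.induction_linear with
  | zero => exact ⟨0, map_zero _⟩
  | add v w hv hw =>
    obtain ⟨⟨x, rfl⟩, ⟨y, rfl⟩⟩ := And.intro hv hw
    exact ⟨x + y, map_add _ _ _⟩
  | single a q =>
    obtain ⟨g, rfl⟩ := QuotientGroup.mk_surjective a
    exact ⟨_, cosetProj_single H g q⟩

theorem IsAugIdem.unique {H : Subgroup G} {e e' : MonoidAlgebra ℚ G} (h : IsAugIdem H e)
    (h' : IsAugIdem H e') : e = e' := by
  rw [← h.2 e' h'.1.1 h'.1.2, h.1.1.2, h'.2 e h.1.1 h.1.2]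

variable [Fintype G]

theorem coeff_mul_avg (H : Subgroup G) (x : MonoidAlgebra ℚ G) (g : G) :
    (x * avg H).coeff g = (Nat.card H : ℚ)⁻¹ * (cosetProj H x).coeff (g : G ⧸ H) := by
  classical
  induction x using MonoidAlgebra.induction_linear with
  | zero => simp
  | add x y hx hy => simp [add_mul, hx, hy, mul_add]
  | single h q =>
    simp [cosetProj_single, MonoidAlgebra.coeff_single_mul_apply, coeff_avg, Finsupp.single_apply,
      QuotientGroup.eq, mul_comm]

theorem cosetProj_eq_zero_iff {H : Subgroup G} {x : MonoidAlgebra ℚ G} :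
    cosetProj H x = 0 ↔ x * avg H = 0 := by
  have card_ne_zero : (Nat.card H : ℚ)⁻¹ ≠ 0 := inv_ne_zero (by exact_mod_cast Nat.card_pos.ne')
  refine ⟨fun h => ?_, fun h => ?_⟩
  · ext g
    simp [coeff_mul_avg, h]
  · ext a
    obtain ⟨g, rfl⟩ := QuotientGroup.mk_surjective a
    simpa [coeff_mul_avg, card_ne_zero] using congrArg (fun y => y.coeff g) h

theorem mul_avg_top (H : Subgroup G) (x : MonoidAlgebra ℚ G) :
    x * avg ⊤ = ((cosetProj H x).coeff.sum fun _ a => a) • avg (⊤ : Subgroup G) := by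
  induction x using MonoidAlgebra.induction_linear with
  | zero => simp
  | add x y hx hy =>
    rw [add_mul, hx, hy, map_add, MonoidAlgebra.coeff_add, ← add_smul,
      Finsupp.sum_add_index' (fun _ => rfl) fun _ _ _ => rfl]
  | single g q =>
    rw [cosetProj_single, MonoidAlgebra.coeff_single, Finsupp.sum_single_index rfl,
      ← MonoidAlgebra.smul_of, smul_mul_assoc, of_mul_avg ⊤ trivial]

theorem actsTriviallyOnAug_iff {H : Subgroup G} {f : MonoidAlgebra ℚ G} (hf : IsCentralIdem f) :
    ActsTriviallyOnAug H f ↔ f * (avg H - avg ⊤) = avg H - avg ⊤ := by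
  have sum_eq_zero_iff (x : MonoidAlgebra ℚ G) :
      ((cosetProj H x).coeff.sum fun _ a => a) = 0 ↔ x * avg ⊤ = 0 := by
    have avg_ne_zero : avg (⊤ : Subgroup G) ≠ 0 := fun h => by
      simpa [coeff_avg] using congrArg (fun y => y.coeff 1) h
    rw [mul_avg_top H, smul_eq_zero, or_iff_left avg_ne_zero]
  have act_eq_iff (x : MonoidAlgebra ℚ G) :
      (Representation.ofMulAction ℚ G (G ⧸ H)).asAlgebraHom f (cosetProj H x) = cosetProj H x ↔
        x * (f * avg H) = x * avg H := by
    rw [← cosetProj_mul, ← sub_eq_zero, ← map_sub, cosetProj_eq_zero_iff, sub_mul, sub_eq_zero,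
      hf.2, mul_assoc]
  simp only [ActsTriviallyOnAug, (cosetProj_surjective H).forall, sum_eq_zero_iff, act_eq_iff]
  refine ⟨fun h => ?_, fun h x hx => ?_⟩
  · have := h (1 - avg ⊤) (by rw [sub_mul, one_mul, avg_mul_avg_of_le le_rfl, sub_self])
    rw [← mul_assoc, ← hf.2, mul_assoc, sub_mul, one_mul, avg_mul_avg_of_ge le_top] at this
    exact this
  · have hxH : x * (avg H - avg ⊤) = x * avg H := by rw [mul_sub, hx, sub_zero]
    rw [← mul_assoc, ← hf.2, mul_assoc, ← hxH, ← mul_assoc, hf.2, mul_assoc, h]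

end Augmentation

section Deflation

variable {G E : Type*} [Group G] [Group E]

/-- The extension of `π` to rational group algebras, a left inverse of `inflation`. -/
abbrev deflation (π : E →* G) : MonoidAlgebra ℚ E →ₐ[ℚ] MonoidAlgebra ℚ G :=
  MonoidAlgebra.mapDomainAlgHom ℚ ℚ π

theorem deflation_of (π : E →* G) (s : E) :
    deflation π (MonoidAlgebra.of ℚ E s) = MonoidAlgebra.of ℚ G (π s) := by
  simp [MonoidAlgebra.of]

theorem deflation_surjective {π : E →* G} (hπ : Function.Surjective π) :
    Function.Surjective (deflation π) := by
  intro x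
  obtain ⟨y, hy⟩ := Finsupp.mapDomain_surjective hπ x.coeff
  exact ⟨.ofCoeff y, MonoidAlgebra.coeff_injective hy⟩

theorem IsCentralIdem.map_deflation {π : E →* G} (hπ : Function.Surjective π)
    {f : MonoidAlgebra ℚ E} (hf : IsCentralIdem f) : IsCentralIdem (deflation π f) := by
  refine ⟨hf.1.map (deflation π), fun x => ?_⟩
  obtain ⟨y, rfl⟩ := deflation_surjective hπ x
  rw [← map_mul, ← map_mul, hf.2]

variable [Fintype G] [Fintype E]

theorem deflation_avg (π : E →* G) (H : Subgroup E) :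
    deflation π (avg H) = avg (H.map π) := by
  classical
  have card_ne_zero : (Nat.card H : ℚ) ≠ 0 := by exact_mod_cast Nat.card_pos.ne'
  have avg_map_mul : avg (H.map π) * deflation π (avg H) = deflation π (avg H) := by
    refine avg_mul_of_leftInv _ ?_
    rintro _ ⟨h, hh, rfl⟩
    rw [← deflation_of, ← map_mul, of_mul_avg H hh]
  rw [← avg_map_mul]
  conv_lhs => enter [2, 2]; unfold avg
  rw [map_smul, map_sum, mul_smul_comm, Finset.mul_sum, Finset.sum_congr rfl fun (h : H) _ =>
      (congrArg _ (deflation_of π h)).trans (avg_mul_of _ (Subgroup.mem_map_of_mem π h.2)),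
    Finset.sum_const, Finset.card_univ, ← Nat.card_eq_fintype_card, ← Nat.cast_smul_eq_nsmul ℚ,
    inv_smul_smul₀ card_ne_zero]

end Deflation

section Inflation

variable {G E : Type*} [Group G] [Group E] [Fintype G] [Fintype E] {π : E →* G}
  (hπ : Function.Surjective π)

theorem coeff_inflation (x : MonoidAlgebra ℚ G) (s : E) :
    (inflation π hπ x).coeff s = (Nat.card π.ker : ℚ)⁻¹ * x.coeff (π s) := by
  rw [← coeff_cosetSum]
  rfl

theorem inflation_mul (x : MonoidAlgebra ℚ G) (y : MonoidAlgebra ℚ E) :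
    inflation π hπ x * y = inflation π hπ (x * deflation π y) := by
  induction y using MonoidAlgebra.induction_on with
  | of s =>
    ext t
    rw [deflation_of, coeff_inflation, MonoidAlgebra.of_apply, MonoidAlgebra.of_apply,
      MonoidAlgebra.coeff_mul_single_apply, MonoidAlgebra.coeff_mul_single_apply, coeff_inflation,
      map_mul, map_inv, mul_one, mul_one]
  | add x y hx hy => rw [mul_add, map_add, mul_add, map_add, hx, hy]
  | smul c x hx => rw [mul_smul_comm, map_smul, mul_smul_comm, map_smul, hx]

theorem mul_inflation (x : MonoidAlgebra ℚ G) (y : MonoidAlgebra ℚ E) :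
    y * inflation π hπ x = inflation π hπ (deflation π y * x) := by
  induction y using MonoidAlgebra.induction_on with
  | of s =>
    ext t
    rw [deflation_of, coeff_inflation, MonoidAlgebra.of_apply, MonoidAlgebra.of_apply,
      MonoidAlgebra.coeff_single_mul_apply, MonoidAlgebra.coeff_single_mul_apply, coeff_inflation,
      map_mul, map_inv, one_mul, one_mul]
  | add x y hx hy => rw [add_mul, map_add, add_mul, map_add, hx, hy]
  | smul c x hx => rw [smul_mul_assoc, map_smul, smul_mul_assoc, map_smul, hx]

theorem inflation_injective : Function.Injective (inflation π hπ) := by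
  intro x y h
  have card_ne_zero : (Nat.card π.ker : ℚ)⁻¹ ≠ 0 :=
    inv_ne_zero (by exact_mod_cast Nat.card_pos.ne')
  ext g
  obtain ⟨s, rfl⟩ := hπ g
  refine mul_left_cancel₀ card_ne_zero ?_
  rw [← coeff_inflation hπ, h, coeff_inflation hπ]

theorem deflation_inflation (x : MonoidAlgebra ℚ G) : deflation π (inflation π hπ x) = x := by
  apply inflation_injective hπ
  rw [← mul_one (deflation π _), ← mul_inflation, ← map_mul, mul_one]

theorem inflation_one : inflation π hπ 1 = avg π.ker := by
  classical
  ext s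
  rw [coeff_inflation, coeff_avg, MonoidAlgebra.one_def, MonoidAlgebra.coeff_single,
    Finsupp.single_apply]
  simp [MonoidHom.mem_ker, eq_comm]

theorem inflation_deflation (y : MonoidAlgebra ℚ E) :
    inflation π hπ (deflation π y) = inflation π hπ 1 * y := by
  rw [inflation_mul, one_mul]

theorem inflation_avg (H : Subgroup G) : inflation π hπ (avg H) = avg (H.comap π) := by
  rw [← Subgroup.map_comap_eq_self_of_surjective hπ H, ← deflation_avg, inflation_deflation,
    inflation_one, Subgroup.map_comap_eq_self_of_surjective hπ H]
  exact avg_mul_avg_of_le (Subgroup.ker_le_comap π H)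

theorem IsCentralIdem.map_inflation {f : MonoidAlgebra ℚ G} (hf : IsCentralIdem f) :
    IsCentralIdem (inflation π hπ f) :=
  ⟨hf.1.map (inflation π hπ), fun x => by rw [inflation_mul, mul_inflation, hf.2]⟩

omit [Fintype G] [Fintype E] in
include hπ in
theorem actsTriviallyOnAug_comap_iff [Finite E] {H : Subgroup G} {f : MonoidAlgebra ℚ E}
    (hf : IsCentralIdem f) :
    ActsTriviallyOnAug (H.comap π) f ↔ ActsTriviallyOnAug H (deflation π f) := by
  cases nonempty_fintype E
  have := Finite.of_surjective π hπ
  cases nonempty_fintype G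
  rw [actsTriviallyOnAug_iff hf, actsTriviallyOnAug_iff (hf.map_deflation hπ),
    ← Subgroup.comap_top π, ← inflation_avg hπ, ← inflation_avg hπ, ← map_sub, mul_inflation,
    (inflation_injective hπ).eq_iff]

theorem inflation_augIdem (H : Subgroup G) :
    inflation π hπ (augIdem H) = augIdem (H.comap π) := by
  have h := augIdem_spec H
  have hc := h.1.1.map_inflation hπ
  refine IsAugIdem.unique ⟨⟨hc, ?_⟩, fun f hf hfa => ?_⟩ (augIdem_spec _)
  · rw [actsTriviallyOnAug_comap_iff hπ hc, deflation_inflation]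
    exact h.1.2
  · rw [inflation_mul,
      h.2 _ (hf.map_deflation hπ) ((actsTriviallyOnAug_comap_iff hπ hf).mp hfa)]

theorem IsIrredCentralIdem.map_inflation {ε : MonoidAlgebra ℚ G} (hε : IsIrredCentralIdem ε) :
    IsIrredCentralIdem (inflation π hπ ε) := by
  refine ⟨hε.1.map_inflation hπ, (map_ne_zero_iff _ (inflation_injective hπ)).mpr hε.2.1,
    fun f hf => ?_⟩
  rw [inflation_mul]
  exact (hε.2.2 _ (hf.map_deflation hπ)).imp (fun h => by rw [h, map_zero]) fun h => by rw [h]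

theorem IsIrredCentralIdem.map_deflation {ε : MonoidAlgebra ℚ E} (hε : IsIrredCentralIdem ε)
    (h : inflation π hπ (deflation π ε) = ε) : IsIrredCentralIdem (deflation π ε) := by
  refine ⟨hε.1.map_deflation hπ, fun h' => hε.2.1 (by rw [← h, h', map_zero]), fun f hf => ?_⟩
  have deflation_mul : deflation π ε * f = deflation π (ε * inflation π hπ f) := by
    rw [map_mul, deflation_inflation]
  rw [deflation_mul]
  exact (hε.2.2 _ (hf.map_inflation hπ)).imp (fun h => by rw [h, map_zero]) fun h => by rw [h]

theorem inflation_deflation_of_mul_inflation {ε : MonoidAlgebra ℚ E} {e : MonoidAlgebra ℚ G}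
    (h : ε * inflation π hπ e = ε) : inflation π hπ (deflation π ε) = ε := by
  rw [inflation_deflation, ← h, mul_inflation, ← map_mul, one_mul]

/-- Inflation as a bijection between the irreducible central idempotents contained in `e` and
those contained in its inflation `e'`. -/
def compEquiv {e : MonoidAlgebra ℚ G} {e' : MonoidAlgebra ℚ E} (he : inflation π hπ e = e') :
    Comp e ≃ Comp e' where
  toFun ε := ⟨inflation π hπ ε.1, ε.2.1.map_inflation hπ, by rw [← he, ← map_mul, ε.2.2]⟩
  invFun ε :=
    have h := inflation_deflation_of_mul_inflation hπ (by rw [he]; exact ε.2.2)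
    ⟨deflation π ε.1, ε.2.1.map_deflation hπ h, by
      conv_lhs => rw [← deflation_inflation hπ e, ← map_mul, he, ε.2.2]⟩
  left_inv ε := Subtype.ext (deflation_inflation hπ _)
  right_inv ε := Subtype.ext (inflation_deflation_of_mul_inflation hπ (by rw [he]; exact ε.2.2))

end Inflation

section InflatedCharacters

theorem IsCentralIdem.finite_corner {G : Type*} [Group G] [Finite G] {ε : MonoidAlgebra ℚ G}
    (hε : IsCentralIdem ε) : Module.Finite (Subring.center hε.1.Corner) hε.1.Corner :=
  finite_center_of_surjective (K := ℚ) _ hε.toCorner_surjective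

variable {G E : Type*} [Group G] [Group E] [Fintype G] [Fintype E] {π : E →* G}
  (hπ : Function.Surjective π)

/-- The action of `ℚ[G]` from which an action of `ℚ[E]` belonging to an inflated idempotent is
inflated. -/
def BelongsTo.compInflation {C V : Type*} [Field C] [AddCommGroup V] [Module C V]
    {s : MonoidAlgebra ℚ E →+* Module.End C V} {ε : MonoidAlgebra ℚ G}
    (h : BelongsTo s (inflation π hπ ε)) : MonoidAlgebra ℚ G →+* Module.End C V where
  toFun x := s (inflation π hπ x)
  map_one' := by
    rw [← mul_one (s _), ← h.map_eq_one, ← map_mul, ← map_mul, one_mul]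
  map_mul' a b := by rw [map_mul, map_mul]
  map_zero' := by rw [map_zero, map_zero]
  map_add' a b := by rw [map_add, map_add]

namespace BelongsTo

variable {C V : Type*} [Field C] [AddCommGroup V] [Module C V]
  {s : MonoidAlgebra ℚ E →+* Module.End C V} {ε : MonoidAlgebra ℚ G}
  (h : BelongsTo s (inflation π hπ ε))

theorem compInflation_deflation (y : MonoidAlgebra ℚ E) :
    h.compInflation hπ (deflation π y) = s y := by
  change s (inflation π hπ (deflation π y)) = s y
  rw [inflation_deflation, map_mul]
  exact (congrArg (· * s y) (h.compInflation hπ).map_one).trans (one_mul _)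

theorem belongsTo_compInflation : BelongsTo (h.compInflation hπ) ε := by
  refine ⟨?_, h.map_eq_one⟩
  rw [← h.span_range_eq_top]
  congr 1
  ext T
  simp only [Set.mem_range, (deflation_surjective hπ).exists, compInflation_deflation]

end BelongsTo

variable {ε : MonoidAlgebra ℚ G} (hε : IsIrredCentralIdem ε) {φ : G → ℂ} {ψ : E → ℂ}
  (hφ : IsAbsIrrCharIn ε φ) (hψ : IsAbsIrrCharIn (inflation π hπ ε) ψ)

include hψ in
theorem hdim_inflation : hdim (inflation π hπ ε) (hε.map_inflation hπ) = hdim ε hε := by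
  obtain ⟨m, σ, hm, hσ, -⟩ := hψ.exists_belongsTo (hε.map_inflation hπ)
  have : NeZero m := ⟨hm⟩
  have := (hε.map_inflation hπ).1.finite_corner
  have := hε.1.finite_corner
  rw [hσ.hdim_eq_finrank, (hσ.belongsTo_compInflation hπ).hdim_eq_finrank]

include hε hφ hψ

theorem cinner_indUnit_inflation (H : Subgroup E) :
    cinner ψ (indUnit H) = cinner φ (indUnit (H.map π)) := by
  obtain ⟨m, σ, hm, hσ, rfl⟩ := hψ.exists_belongsTo (hε.map_inflation hπ)
  obtain ⟨n, ρ, hn, hρ, rfl⟩ := hφ.exists_belongsTo hε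
  have : NeZero m := ⟨hm⟩
  have : NeZero n := ⟨hn⟩
  have := hε.1.finite_corner
  rw [cinner_character_indUnit, cinner_character_indUnit, ← hσ.compInflation_deflation hπ,
    deflation_avg, (hσ.belongsTo_compInflation hπ).trace_eq hε hρ (avg_isIdempotentElem _)]

theorem cinner_augChar_inflation (H : Subgroup E) :
    cinner ψ (augChar H) = cinner φ (augChar (H.map π)) := by
  rw [augChar_eq, augChar_eq, cinner_sub_right, cinner_sub_right,
    cinner_indUnit_inflation hπ hε hφ hψ, cinner_indUnit_inflation hπ hε hφ hψ,
    Subgroup.map_top_of_surjective π hπ]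

end InflatedCharacters

section DecompositionGroups

open NumberField

variable {K₀ L M : Type*} [Field K₀] [Field L] [Field M] [Algebra K₀ L] [Algebra K₀ M] [Algebra L M]
  [IsScalarTower K₀ L M] [Normal K₀ L]

theorem comap_smul_eq_restrictNormalHom_smul (g : Gal(M/K₀)) (w : InfinitePlace M) :
    (g • w).comap (algebraMap L M) =
      AlgEquiv.restrictNormalHom L g • w.comap (algebraMap L M) := by
  refine DFunLike.ext _ _ fun x => ?_
  rw [InfinitePlace.comap_apply, InfinitePlace.smul_apply, InfinitePlace.smul_apply,
    InfinitePlace.comap_apply, ← AlgEquiv.aut_inv, ← AlgEquiv.aut_inv, ← map_inv]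
  exact congrArg w (AlgEquiv.restrictNormal_commutes g⁻¹ L x).symm

theorem restrictNormalHom_restrictScalars (k : Gal(M/L)) :
    AlgEquiv.restrictNormalHom L (k.restrictScalars K₀) = 1 :=
  AlgEquiv.ext fun x => (algebraMap L M).injective <|
    (AlgEquiv.restrictNormal_commutes (k.restrictScalars K₀) L x).trans (k.commutes x)

theorem map_stabilizer_restrictNormalHom [IsGalois K₀ M] (w : InfinitePlace M) :
    (MulAction.stabilizer Gal(M/K₀) w).map (AlgEquiv.restrictNormalHom L) =
      MulAction.stabilizer Gal(L/K₀) (w.comap (algebraMap L M)) := by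
  have : IsGalois L M := IsGalois.tower_top_of_isGalois K₀ L M
  ext g
  obtain ⟨h, rfl⟩ := AlgEquiv.restrictNormalHom_surjective (F := K₀) (K₁ := L) M g
  rw [Subgroup.mem_map, MulAction.mem_stabilizer_iff, ← comap_smul_eq_restrictNormalHom_smul]
  refine ⟨?_, fun hw => ?_⟩
  · rintro ⟨h', hw, hh'⟩
    rw [comap_smul_eq_restrictNormalHom_smul, ← hh', ← comap_smul_eq_restrictNormalHom_smul,
      MulAction.mem_stabilizer_iff.mp hw]
  · obtain ⟨k, hk⟩ := InfinitePlace.exists_smul_eq_of_comap_eq (k := L) hw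
    refine ⟨k.restrictScalars K₀ * h, ?_, ?_⟩
    · rw [MulAction.mem_stabilizer_iff, mul_smul]
      exact hk
    · rw [map_mul, restrictNormalHom_restrictScalars, one_mul]

variable {Γ Ξ : Type*} [Group Γ] [Group Ξ] (τL : Gal(L/K₀) ≃* Γ) (τM : Gal(M/K₀) ≃* Ξ)

theorem restrictHom_apply (g : Gal(M/K₀)) :
    restrictHom τL τM (τM g) = τL (AlgEquiv.restrictNormalHom L g) := by
  simp [restrictHom]

omit [Normal K₀ L] in
theorem apply_mem_galImage_iff {K : Type*} [Field K] [Algebra K₀ K] [Algebra K L]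
    [IsScalarTower K₀ K L] (g : Gal(L/K₀)) :
    τL g ∈ galImage K₀ L K τL ↔ ∀ x : K, g (algebraMap K L x) = algebraMap K L x :=
  (Subgroup.mem_map_iff_mem τL.injective).trans <|
    (IntermediateField.mem_fixingSubgroup_iff _ _).trans Set.forall_mem_range

theorem galImage_comap_restrictHom {K : Type*} [Field K] [Algebra K₀ K] [Algebra K L] [Algebra K M]
    [IsScalarTower K₀ K L] [IsScalarTower K₀ K M] [IsScalarTower K L M] :
    (galImage K₀ L K τL).comap (restrictHom τL τM) = galImage K₀ M K τM := by
  ext s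
  obtain ⟨g, rfl⟩ := τM.surjective s
  rw [Subgroup.mem_comap, restrictHom_apply, apply_mem_galImage_iff, apply_mem_galImage_iff]
  refine forall_congr' fun x => ?_
  rw [← (algebraMap L M).injective.eq_iff, IsScalarTower.algebraMap_apply K L M]
  exact Eq.congr_left (AlgEquiv.restrictNormal_commutes g L _)

variable [NumberField K₀] [FiniteDimensional K₀ L]

theorem exists_map_stabilizer_eq_map_conj_decompGroup [IsGalois K₀ L] {v : InfinitePlace K₀}
    {w : InfinitePlace L} (hw : w.comap (algebraMap K₀ L) = v) :
    ∃ g : Γ, (MulAction.stabilizer Gal(L/K₀) w).map τL.toMonoidHom =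
      (decompGroup K₀ L τL v).map (MulAut.conj g).toMonoidHom := by
  have hv := (InfinitePlace.comap_surjective (k := K₀) (K := L) v).choose_spec
  obtain ⟨g, rfl⟩ := InfinitePlace.exists_smul_eq_of_comap_eq (hv.trans hw.symm)
  refine ⟨τL g, ?_⟩
  rw [MulAction.stabilizer_smul_eq_stabilizer_map_conj, decompGroup, Subgroup.map_map,
    Subgroup.map_map]
  congr 1
  ext x
  simp

variable [FiniteDimensional K₀ M]

theorem exists_map_decompGroup_eq_map_conj [IsGalois K₀ L] [IsGalois K₀ M]
    (v : InfinitePlace K₀) :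
    ∃ g : Γ, (decompGroup K₀ M τM v).map (restrictHom τL τM) =
      (decompGroup K₀ L τL v).map (MulAut.conj g).toMonoidHom := by
  set w := (InfinitePlace.comap_surjective (k := K₀) (K := M) v).choose with hw
  have comap_comap : (w.comap (algebraMap L M)).comap (algebraMap K₀ L) = v := by
    rw [← InfinitePlace.comap_comp, ← IsScalarTower.algebraMap_eq]
    exact (InfinitePlace.comap_surjective (k := K₀) (K := M) v).choose_spec
  obtain ⟨g, hg⟩ := exists_map_stabilizer_eq_map_conj_decompGroup τL comap_comap
  refine ⟨g, ?_⟩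
  rw [← hg, ← map_stabilizer_restrictNormalHom, decompGroup, ← hw, Subgroup.map_map,
    Subgroup.map_map]
  congr 1
  ext x
  exact restrictHom_apply τL τM x

end DecompositionGroups

section Ranks

open NumberField

variable {G : Type*} [Group G] [Fintype G]

theorem cinner_infChar (K₀ L : Type*) [Field K₀] [NumberField K₀] [Field L] [Algebra K₀ L]
    [FiniteDimensional K₀ L] (τ : Gal(L/K₀) ≃* G) (φ : G → ℂ) :
    cinner (infChar K₀ L τ) φ = (starRingEnd ℂ) (∑ v : InfinitePlace K₀,
      cinner φ (indUnit (decompGroup K₀ L τ v)) - cinner φ (indUnit (⊤ : Subgroup G))) := by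
  rw [cinner_comm, ← cinner_sum_right, ← cinner_sub_right]
  congr 2
  funext g
  rw [infChar, Pi.sub_apply, indUnit_top, Finset.sum_apply]
  ring

variable {K₀ L M : Type*} [Field K₀] [NumberField K₀] [Field L] [Field M]
  [Algebra K₀ L] [Algebra K₀ M] [Algebra L M] [IsScalarTower K₀ L M] [FiniteDimensional K₀ L]
  [FiniteDimensional K₀ M] [IsGalois K₀ L] [IsGalois K₀ M]
  {Γ Ξ : Type*} [Group Γ] [Fintype Γ] [Group Ξ] [Fintype Ξ]
  (τL : Gal(L/K₀) ≃* Γ) (τM : Gal(M/K₀) ≃* Ξ)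

theorem cinner_infChar_inflation {ε : MonoidAlgebra ℚ Γ} (hε : IsIrredCentralIdem ε)
    {φ : Γ → ℂ} {ψ : Ξ → ℂ} (hφ : IsAbsIrrCharIn ε φ)
    (hψ : IsAbsIrrCharIn (inflation (restrictHom τL τM) (restrictHom_surjective τL τM) ε) ψ) :
    cinner (infChar K₀ M τM) ψ = cinner (infChar K₀ L τL) φ := by
  have hπ := restrictHom_surjective τL τM
  have decomp_eq (v : InfinitePlace K₀) :
      cinner ψ (indUnit (decompGroup K₀ M τM v)) = cinner φ (indUnit (decompGroup K₀ L τL v)) := by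
    obtain ⟨g, hg⟩ := exists_map_decompGroup_eq_map_conj τL τM v
    rw [cinner_indUnit_inflation hπ hε hφ hψ, hg, indUnit_map_conj]
  rw [cinner_infChar, cinner_infChar, Finset.sum_congr rfl fun v _ => decomp_eq v,
    cinner_indUnit_inflation hπ hε hφ hψ, Subgroup.map_top_of_surjective _ hπ]

theorem fixedRank_compEquiv {Γ' : Subgroup Γ} {Ξ' : Subgroup Ξ}
    (hΞ' : Ξ'.map (restrictHom τL τM) = Γ')
    (he : inflation (restrictHom τL τM) (restrictHom_surjective τL τM) (augIdem Γ') = augIdem Ξ')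
    {φ : Comp (augIdem Γ') → Γ → ℂ} (hφ : ∀ ε, IsAbsIrrCharIn ε.1 (φ ε))
    {ψ : Comp (augIdem Ξ') → Ξ → ℂ} (hψ : ∀ ε, IsAbsIrrCharIn ε.1 (ψ ε))
    (ε : Comp (augIdem Γ')) :
    fixedRank K₀ M τM Ξ' ψ (compEquiv (restrictHom_surjective τL τM) he ε) =
      fixedRank K₀ L τL Γ' φ ε := by
  have hπ := restrictHom_surjective τL τM
  have hψε := hψ (compEquiv hπ he ε)
  rw [fixedRank, fixedRank, galRank, galRank, cinner_augChar_inflation hπ ε.2.1 (hφ ε) hψε,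
    cinner_augChar_inflation hπ ε.2.1 (hφ ε) hψε, Subgroup.map_bot, hΞ',
    cinner_infChar_inflation τL τM ε.2.1 (hφ ε) hψε]
  exact congrArg (fun n : ℕ => _ / _ * ((n : ℂ)⁻¹ * _)) (hdim_inflation hπ ε.2.1 hψε)

end Ranks

section Integrality

theorem padicNorm_le_one_of_mem_ZS {p : Nat.Primes} {q : ℚ} (hq : q ∈ ZS {p}) :
    padicNorm p q ≤ 1 := by
  have : Fact (p : ℕ).Prime := ⟨p.2⟩
  obtain ⟨a, b, hb, -, rfl⟩ := hq
  rw [padicNorm.div, (padicNorm.int_eq_one_iff (p := p) b).mpr (hb p rfl), div_one]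
  exact padicNorm.of_int a

theorem coeff_mem_ZS_of_mem_groupRing {G : Type*} [Group G] {S : Set Nat.Primes}
    {x : MonoidAlgebra ℚ G} (hx : x ∈ groupRing S G) (g : G) : x.coeff g ∈ ZS S := by
  classical
  induction hx using Submodule.span_induction with
  | mem x hx =>
    obtain ⟨h, rfl⟩ := hx
    rw [MonoidAlgebra.of_apply, MonoidAlgebra.coeff_single, Finsupp.single_apply]
    split_ifs
    exacts [(ZS S).one_mem, (ZS S).zero_mem]
  | zero => exact (ZS S).zero_mem
  | add x y _ _ hx hy => exact (ZS S).add_mem hx hy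
  | smul c x _ hx => exact (ZS S).mul_mem c.2 hx

variable {G : Type*} [Group G]

theorem eq_zero_of_isIdempotentElem_of_padicNorm_lt_one [Finite G] {p : ℕ} [Fact p.Prime]
    {e : MonoidAlgebra ℚ G} (he : IsIdempotentElem e) (h : ∀ g, padicNorm p (e.coeff g) < 1) :
    e = 0 := by
  -- The largest norm `c` of a coefficient satisfies `c ≤ c * c`, so `c < 1` forces `c = 0`.
  cases nonempty_fintype G
  obtain ⟨g, -, max_g⟩ := Finset.univ.exists_max_image (fun g => padicNorm p (e.coeff g))
    Finset.univ_nonempty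
  have le_mul_self :
      padicNorm p (e.coeff g) ≤ padicNorm p (e.coeff g) * padicNorm p (e.coeff g) := by
    conv_lhs => rw [← he.eq, coeff_mul_eq_sum]
    refine padicNorm.sum_le Finset.univ_nonempty fun t _ => ?_
    rw [padicNorm.mul]
    exact mul_le_mul (max_g _ (Finset.mem_univ _)) (max_g _ (Finset.mem_univ _))
      (padicNorm.nonneg _) (padicNorm.nonneg _)
  have max_le_zero : padicNorm p (e.coeff g) ≤ 0 := by nlinarith [h g]
  ext t
  exact padicNorm.zero_of_padicNorm_eq_zero
    (le_antisymm ((max_g t (Finset.mem_univ _)).trans max_le_zero) (padicNorm.nonneg _))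

variable {E : Type*} [Fintype G] [Group E] [Fintype E] {π : E →* G} (hπ : Function.Surjective π)

theorem inv_card_ker_mem_ZS {S : Set Nat.Primes} {e : MonoidAlgebra ℚ G}
    (he : IsIdempotentElem e) (he0 : e ≠ 0)
    (hS : ∀ p ∈ S, inflation π hπ e ∈ groupRing {p} E) : (Nat.card π.ker : ℚ)⁻¹ ∈ ZS S := by
  refine ⟨1, Nat.card π.ker, fun p hp hdvd => he0 ?_, by exact_mod_cast Nat.card_pos.ne', by simp⟩
  have : Fact (p : ℕ).Prime := ⟨p.2⟩
  refine eq_zero_of_isIdempotentElem_of_padicNorm_lt_one (p := p) he fun g => ?_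
  obtain ⟨s, rfl⟩ := hπ g
  have card_ne_zero : (Nat.card π.ker : ℚ) ≠ 0 := by exact_mod_cast Nat.card_pos.ne'
  have coeff_eq : e.coeff (π s) = ((Nat.card π.ker : ℤ) : ℚ) * (inflation π hπ e).coeff s := by
    rw [coeff_inflation, Int.cast_natCast, mul_inv_cancel_left₀ card_ne_zero]
  rw [coeff_eq, padicNorm.mul]
  exact mul_lt_one_of_nonneg_of_lt_one_left (padicNorm.nonneg _)
    ((padicNorm.int_lt_one_iff _).mpr hdvd)
    (padicNorm_le_one_of_mem_ZS (coeff_mem_ZS_of_mem_groupRing (hS p hp) s))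

end Integrality

section Orders

variable {S : Set Nat.Primes}

theorem IsOrder.sup_lmul {A : Type*} [Ring A] [Algebra ℚ A] {O : ZSub S A} (hO : IsOrder S 1 O)
    {ε : A} (hε : IsCentralIdem ε) : IsOrder S 1 (O ⊔ lmul ε O) where
  le_corner x _ := ⟨one_mul x, mul_one x⟩
  one_mem := Submodule.mem_sup_left hO.one_mem
  mul_mem := by
    rintro x hx y hy
    obtain ⟨a, ha, _, ⟨b, hb, rfl⟩, rfl⟩ := Submodule.mem_sup.mp hx
    obtain ⟨c, hc, _, ⟨d, hd, rfl⟩, rfl⟩ := Submodule.mem_sup.mp hy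
    have expand : (a + ε * b) * (c + ε * d) = a * c + ε * (a * d + b * c + b * d) := by
      have left_comm (x y : A) : x * (ε * y) = ε * (x * y) := by
        rw [← mul_assoc, ← hε.2, mul_assoc]
      have absorb : ε * (ε * (b * d)) = ε * (b * d) := by rw [← mul_assoc, hε.1.eq]
      simp only [add_mul, mul_add, mul_assoc, left_comm, absorb]
      abel
    refine expand ▸ Submodule.add_mem_sup (hO.mul_mem a ha c hc) ⟨_, ?_, rfl⟩
    exact O.add_mem (O.add_mem (hO.mul_mem a ha d hd) (hO.mul_mem b hb c hc)) (hO.mul_mem b hb d hd)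
  fg := hO.fg.sup (hO.fg.map _)
  spans x h1 h2 := Submodule.span_mono (le_sup_left : O ≤ _) (hO.spans x h1 h2)

theorem IsMaximalOrder.mem_of_isCentralIdem {A : Type*} [Ring A] [Algebra ℚ A] {O : ZSub S A}
    (hO : IsMaximalOrder S 1 O) {ε : A} (hε : IsCentralIdem ε) : ε ∈ O := by
  rw [← hO.2 _ (hO.1.sup_lmul hε) le_sup_left]
  exact Submodule.mem_sup_right ⟨1, hO.1.one_mem, mul_one ε⟩

variable {G E : Type*} [Group G] [Group E] {π : E →* G}

/-- The image under deflation of a lattice in `ℚ[E]`. -/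
def deflate (π : E →* G) (Λ : ZSub S (MonoidAlgebra ℚ E)) : ZSub S (MonoidAlgebra ℚ G) :=
  Λ.map ((deflation π).toLinearMap.restrictScalars (ZS S))

theorem IsOrder.deflate {O' : ZSub S (MonoidAlgebra ℚ E)} (hO' : IsOrder S 1 O')
    (hπ : Function.Surjective π) : IsOrder S 1 (deflate π O') where
  le_corner x _ := ⟨one_mul x, mul_one x⟩
  one_mem := ⟨1, hO'.one_mem, map_one (deflation π)⟩
  mul_mem := by
    rintro _ ⟨a, ha, rfl⟩ _ ⟨b, hb, rfl⟩
    exact ⟨a * b, hO'.mul_mem a ha b hb, map_mul (deflation π) a b⟩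
  fg := hO'.fg.map _
  spans x _ _ := by
    obtain ⟨y, rfl⟩ := deflation_surjective hπ x
    have hy := Submodule.mem_map_of_mem (f := (deflation π).toLinearMap)
      (hO'.spans y (one_mul y) (mul_one y))
    rwa [Submodule.map_span] at hy

variable [Fintype G] {H : Subgroup G}

theorem exists_eq_augAvg_mul_of_mem_heckeModule {O : ZSub S (MonoidAlgebra ℚ G)}
    {x : MonoidAlgebra ℚ G} (hx : x ∈ heckeModule H O) :
    ∃ r, augIdem H * avg H * r * (augIdem H * avg H) = x := by
  obtain ⟨⟨a, -, rfl⟩, hinv⟩ := exists_of_mem_heckeModule hx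
  have he := (augIdem_spec H).1.1
  set x := augIdem H * a * avg H with hx
  have aug_mul : augIdem H * x = x := by simp only [hx, ← mul_assoc, he.1.eq]
  have mul_avg : x * avg H = x := by rw [hx, mul_assoc, (avg_isIdempotentElem H).eq]
  exact ⟨x, by rw [mul_assoc (augIdem H), avg_mul_of_leftInv H hinv, aug_mul, ← mul_assoc,
    ← he.2 x, aug_mul, mul_avg]⟩

/-- The additive group of the ring `𝔬`, as a submodule of `ℚ[G]`. -/
def heckeAddEquiv (H : Subgroup G) {O : ZSub S (MonoidAlgebra ℚ G)} (hO : IsOrder S 1 O) :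
    heckeRing H O hO ≃+ heckeModule H O where
  toFun x := ⟨heckeVal x, x.2⟩
  invFun x := ⟨⟨x, exists_eq_augAvg_mul_of_mem_heckeModule x.2⟩, x.2⟩
  map_add' _ _ := rfl

variable [Fintype E]

/-- The image under inflation of a lattice in `ℚ[G]`. -/
def inflate (hπ : Function.Surjective π) (Λ : ZSub S (MonoidAlgebra ℚ G)) :
    ZSub S (MonoidAlgebra ℚ E) :=
  Λ.map ((inflation π hπ : MonoidAlgebra ℚ G →ₗ[ℚ] MonoidAlgebra ℚ E).restrictScalars (ZS S))

omit [Fintype G] in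
theorem IsMaximalOrder.deflate_eq {O : ZSub S (MonoidAlgebra ℚ G)}
    {O' : ZSub S (MonoidAlgebra ℚ E)} (hO : IsMaximalOrder S 1 O) (hO' : IsOrder S 1 O')
    (hπ : Function.Surjective π) (hc : ∀ x ∈ O, cosetSum π x ∈ O')
    (hu : (Nat.card π.ker : ℚ)⁻¹ ∈ ZS S) : deflate π O' = O := by
  have := Finite.of_surjective π hπ
  cases nonempty_fintype G
  exact hO.2 _ (hO'.deflate hπ) fun x hx =>
    ⟨inflation π hπ x, O'.smul_mem ⟨_, hu⟩ (hc x hx), deflation_inflation hπ x⟩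

variable (hπ : Function.Surjective π)

theorem lmul_inflation_eq_inflate (e : MonoidAlgebra ℚ G) (Λ : ZSub S (MonoidAlgebra ℚ E)) :
    lmul (inflation π hπ e) Λ = inflate hπ (lmul e (deflate π Λ)) := by
  rw [inflate, lmul, lmul, deflate, ← Submodule.map_comp, ← Submodule.map_comp]
  congr 1
  exact LinearMap.ext fun a => inflation_mul hπ e a

theorem rmul_inflate (Λ : ZSub S (MonoidAlgebra ℚ G)) (f : MonoidAlgebra ℚ G) :
    rmul (inflate hπ Λ) (inflation π hπ f) = inflate hπ (rmul Λ f) := by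
  rw [inflate, rmul, rmul, inflate, ← Submodule.map_comp, ← Submodule.map_comp]
  congr 1
  exact LinearMap.ext fun x => (map_mul (inflation π hπ) x f).symm

theorem leftInv_comap_inflate (H : Subgroup G) (Λ : ZSub S (MonoidAlgebra ℚ G)) :
    leftInv (H.comap π) (inflate hπ Λ) = inflate hπ (leftInv H Λ) := by
  have of_mul_inflation (s : E) (x : MonoidAlgebra ℚ G) :
      MonoidAlgebra.of ℚ E s * inflation π hπ x =
        inflation π hπ (MonoidAlgebra.of ℚ G (π s) * x) := by
    rw [mul_inflation, deflation_of]
  ext y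
  constructor
  · rintro ⟨⟨x, hx, rfl⟩, hinv⟩
    refine ⟨x, ⟨hx, fun τ hτ => ?_⟩, rfl⟩
    obtain ⟨s, rfl⟩ := hπ τ
    exact inflation_injective hπ ((of_mul_inflation s x).symm.trans (hinv s hτ))
  · rintro ⟨x, ⟨hx, hinv⟩, rfl⟩
    exact ⟨⟨x, hx, rfl⟩, fun s hs =>
      (of_mul_inflation s x).trans (congrArg (inflation π hπ) (hinv _ hs))⟩

theorem lmul_inflation_of_isMaximalOrder {O : ZSub S (MonoidAlgebra ℚ G)}
    {O' : ZSub S (MonoidAlgebra ℚ E)} (hO : IsMaximalOrder S 1 O) (hO' : IsOrder S 1 O')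
    (hc : ∀ x ∈ O, cosetSum π x ∈ O') {e : MonoidAlgebra ℚ G} (he : IsIdempotentElem e)
    (hS : ∀ p ∈ S, inflation π hπ e ∈ groupRing {p} E) :
    lmul (inflation π hπ e) O' = inflate hπ (lmul e O) := by
  rw [lmul_inflation_eq_inflate]
  rcases eq_or_ne e 0 with rfl | he0
  · have lmul_zero (Λ : ZSub S (MonoidAlgebra ℚ G)) : lmul 0 Λ = ⊥ := by
      simp [lmul, LinearMap.mulLeft_zero_eq_zero]
    rw [lmul_zero, lmul_zero]
  · rw [hO.deflate_eq hO' hπ hc (inv_card_ker_mem_ZS hπ he he0 hS)]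

variable {hπ}

/-- Inflation as an isomorphism of a lattice onto its image. -/
def inflateEquiv {Λ : ZSub S (MonoidAlgebra ℚ G)} {Λ' : ZSub S (MonoidAlgebra ℚ E)}
    (h : Λ' = inflate hπ Λ) : Λ ≃ₗ[ZS S] Λ' :=
  (Submodule.equivMapOfInjective _ (inflation_injective hπ) Λ).trans (LinearEquiv.ofEq _ _ h.symm)

/-- Inflation as an isomorphism of the rings `𝔬`. -/
def heckeEquiv {H' : Subgroup E} {O : ZSub S (MonoidAlgebra ℚ G)}
    {O' : ZSub S (MonoidAlgebra ℚ E)} (hO : IsOrder S 1 O) (hO' : IsOrder S 1 O')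
    (h : heckeModule H' O' = inflate hπ (heckeModule H O)) :
    heckeRing H O hO ≃+* heckeRing H' O' hO' where
  __ := (heckeAddEquiv H hO).trans
    ((inflateEquiv h).toAddEquiv.trans (heckeAddEquiv H' hO').symm)
  map_mul' _ _ := Subtype.ext (Subtype.ext (map_mul (inflation π hπ) _ _))

end Orders

section Transport

open scoped ENNReal

theorem eq_inv_of_tsum_eq_one {α : Type*} {P w : α → ℝ≥0∞} (hsum : ∑' a, P a = 1)
    (w_ne_zero : ∀ a, w a ≠ 0) (w_ne_top : ∀ a, w a ≠ ⊤)
    (hP : ∀ a b, P a * w a = P b * w b) (a : α) : P a = (w a * ∑' b, (w b)⁻¹)⁻¹ := by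
  refine ENNReal.eq_inv_of_mul_eq_one_left ?_
  rw [← mul_assoc, ← ENNReal.tsum_mul_left, ← hsum]
  refine tsum_congr fun b => ?_
  rw [hP a b, mul_assoc, ENNReal.mul_inv_cancel (w_ne_zero b) (w_ne_top b), mul_one]

variable {R R' : Type*} [Ring R] [Ring R'] (θ : R ≃+* R')

/-- Transport of a finite module along an isomorphism of rings. -/
def FinMod.transport (X : FinMod R) : FinMod R' where
  carrier := X.carrier
  module := Module.compHom X.carrier (θ.symm : R' →+* R)

theorem FinMod.transport_equiv_iff (X : FinMod R) (Y : FinMod R') :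
    FinMod.transport θ X ≈ Y ↔ ∃ f : X.carrier ≃+ Y.carrier, ∀ a x, f (a • x) = θ a • f x := by
  constructor
  · rintro ⟨g⟩
    refine ⟨g.toAddEquiv, fun a x => ?_⟩
    have smul_eq : θ.symm (θ a) • x = a • x := by rw [θ.symm_apply_apply]
    exact (congrArg g smul_eq).symm.trans (g.map_smul (θ a) x)
  · rintro ⟨f, hf⟩
    refine ⟨{ f with map_smul' := fun a x => (hf (θ.symm a) x).trans ?_ }⟩
    rw [θ.apply_symm_apply]
    rfl

theorem FinMod.equiv_of_transport_equiv {X Y : FinMod R}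
    (h : FinMod.transport θ X ≈ FinMod.transport θ Y) : X ≈ Y := by
  obtain ⟨f, hf⟩ := (FinMod.transport_equiv_iff θ X _).mp h
  refine ⟨{ f with map_smul' := fun a x => (hf a x).trans ?_ }⟩
  have smul_eq (y : Y.carrier) : θ.symm (θ a) • y = a • y := by rw [θ.symm_apply_apply]
  exact smul_eq (f x)

/-- The map on isomorphism classes of finite modules induced by an isomorphism of rings. -/
def FinModClass.transport : FinModClass R → FinModClass R' :=
  Quotient.map (FinMod.transport θ) fun X Y ⟨g⟩ =>
    (FinMod.transport_equiv_iff θ X _).mpr ⟨g.toAddEquiv, fun a x => (g.map_smul a x).trans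
      (congrArg (· • (g x : Y.carrier)) (θ.symm_apply_apply a).symm)⟩

theorem FinModClass.transport_bijective : Function.Bijective (FinModClass.transport θ) := by
  constructor
  · rintro ⟨X⟩ ⟨Y⟩ h
    exact Quotient.sound (FinMod.equiv_of_transport_equiv θ (Quotient.exact h))
  · rintro ⟨Y⟩
    exact ⟨⟦FinMod.transport θ.symm Y⟧, Quotient.sound <|
      (FinMod.transport_equiv_iff θ _ Y).mpr ⟨AddEquiv.refl _, fun _ _ => rfl⟩⟩

variable {θ} in
theorem card_aut_eq_of_semilinear {V W : Type*} [AddCommGroup V] [Module R V] [AddCommGroup W]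
    [Module R' W] (f : V ≃+ W) (hf : ∀ a x, f (a • x) = θ a • f x) :
    Nat.card (V ≃ₗ[R] V) = Nat.card (W ≃ₗ[R'] W) := by
  have := RingHomInvPair.of_ringEquiv θ
  have := RingHomInvPair.symm (θ : R →+* R') (θ.symm : R' →+* R)
  let F : V ≃ₛₗ[(θ : R →+* R')] W := { f with map_smul' := hf }
  exact Nat.card_congr
    { toFun g := (F.symm.trans g).trans F
      invFun g := (F.trans g).trans F.symm
      left_inv g := by ext; simp
      right_inv g := by ext; simp }

end Transport

section Laws

variable {G : Type*} [Group G] [Fintype G] {S : Set Nat.Primes} {H : Subgroup G}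
  {O : ZSub S (MonoidAlgebra ℚ G)}

theorem mul_avg_mem_heckeModule (hO : IsMaximalOrder S 1 O) (ε : Comp (augIdem H)) :
    ε.1 * avg H ∈ heckeModule H O := by
  have hε := ε.2.1.1
  refine ⟨⟨ε.1, ⟨ε.1, hO.mem_of_isCentralIdem hε, ?_⟩, rfl⟩, fun τ hτ => ?_⟩
  · exact ((augIdem_spec H).1.1.2 ε.1).trans ε.2.2
  · rw [← mul_assoc, ← hε.2, mul_assoc, of_mul_avg H hτ]

variable {hO : IsOrder S 1 O}

theorem cardPow_pos (hmax : IsMaximalOrder S 1 O) (v : Comp (augIdem H) → ℂ)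
    (X : FinMod (heckeRing H O hO)) : 0 < cardPow v X := by
  refine finprod_induction (fun x : ℝ => 0 < x) one_pos (fun _ _ => mul_pos) fun ε => ?_
  have compPart_nonempty : (compPart ε X).Nonempty :=
    ⟨0, (heckeAddEquiv H hO).symm ⟨_, mul_avg_mem_heckeModule hmax ε⟩, rfl, 0, (smul_zero _).symm⟩
  refine Real.rpow_pos_of_pos ?_ _
  exact_mod_cast (Set.ncard_pos (Set.toFinite _)).mpr compPart_nonempty

/-- The inverse of the relative probability of `X`. -/
def moduleWeight (v : Comp (augIdem H) → ℂ) (X : FinMod (heckeRing H O hO)) : ENNReal :=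
  ENNReal.ofReal (cardPow v X * Nat.card (X.carrier ≃ₗ[heckeRing H O hO] X.carrier))

theorem moduleWeight_ne_zero (hmax : IsMaximalOrder S 1 O) (v : Comp (augIdem H) → ℂ)
    (X : FinMod (heckeRing H O hO)) : moduleWeight v X ≠ 0 := by
  rw [moduleWeight, Ne, ENNReal.ofReal_eq_zero, not_le]
  have : Finite (X.carrier ≃ₗ[heckeRing H O hO] X.carrier) := DFunLike.finite _
  exact mul_pos (cardPow_pos hmax v X) (by exact_mod_cast Nat.card_pos)

theorem IsRandomModuleLaw.mul_moduleWeight_out_eq {v : Comp (augIdem H) → ℂ}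
    {P : PMF (FinModClass (heckeRing H O hO))} (hP : IsRandomModuleLaw v P)
    (c d : FinModClass (heckeRing H O hO)) :
    P c * moduleWeight v c.out = P d * moduleWeight v d.out := by
  have := hP c.out d.out
  rwa [Quotient.out_eq, Quotient.out_eq] at this

variable {E : Type*} [Group E] [Fintype E] {H' : Subgroup E} {O' : ZSub S (MonoidAlgebra ℚ E)}
  {hO' : IsOrder S 1 O'} {π : E →* G} {hπ : Function.Surjective π}
  {θ : heckeRing H O hO ≃+* heckeRing H' O' hO'}
  (hθ : ∀ a, heckeVal (θ a) = inflation π hπ (heckeVal a))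
  (he : inflation π hπ (augIdem H) = augIdem H') (ha : inflation π hπ (avg H) = avg H')

include hθ ha

theorem compPart_compEquiv {X : FinMod (heckeRing H O hO)} {Y : FinMod (heckeRing H' O' hO')}
    (f : X.carrier ≃+ Y.carrier) (hf : ∀ a x, f (a • x) = θ a • f x) (ε : Comp (augIdem H)) :
    compPart (compEquiv hπ he ε) Y = f '' compPart ε X := by
  have heckeVal_eq_iff (a : heckeRing H O hO) :
      heckeVal (θ a) = (compEquiv hπ he ε).1 * avg H' ↔ heckeVal a = ε.1 * avg H := by
    rw [hθ, ← ha, ← (inflation_injective hπ).eq_iff, map_mul]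
    rfl
  ext y
  constructor
  · rintro ⟨b, hb, z, rfl⟩
    refine ⟨θ.symm b • f.symm z, ⟨θ.symm b, (heckeVal_eq_iff _).mp ?_, _, rfl⟩, ?_⟩
    · rw [θ.apply_symm_apply, hb]
    · rw [hf, θ.apply_symm_apply, f.apply_symm_apply]
  · rintro ⟨_, ⟨a, ha', x, rfl⟩, rfl⟩
    exact ⟨θ a, (heckeVal_eq_iff a).mpr ha', f x, hf a x⟩

variable {v : Comp (augIdem H) → ℂ} {v' : Comp (augIdem H') → ℂ}
  (hv : ∀ ε, v' (compEquiv hπ he ε) = v ε)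

include hv

theorem cardPow_eq_of_semilinear {X : FinMod (heckeRing H O hO)}
    {Y : FinMod (heckeRing H' O' hO')} (f : X.carrier ≃+ Y.carrier)
    (hf : ∀ a x, f (a • x) = θ a • f x) : cardPow v' Y = cardPow v X := by
  rw [cardPow, cardPow, ← finprod_comp_equiv (compEquiv hπ he)]
  refine finprod_congr fun ε => ?_
  rw [compPart_compEquiv hθ he ha f hf, hv, Set.ncard_image_of_injective _ f.injective]

theorem moduleWeight_eq_of_transport_eq {X : FinMod (heckeRing H O hO)}
    {Y : FinMod (heckeRing H' O' hO')} (h : FinModClass.transport θ ⟦X⟧ = ⟦Y⟧) :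
    moduleWeight v' Y = moduleWeight v X := by
  obtain ⟨f, hf⟩ := (FinMod.transport_equiv_iff θ X Y).mp (Quotient.exact h)
  rw [moduleWeight, moduleWeight, cardPow_eq_of_semilinear hθ he ha hv f hf,
    card_aut_eq_of_semilinear f hf]

theorem isRandomModuleLaw_apply_eq (hmax : IsMaximalOrder S 1 O)
    {P : PMF (FinModClass (heckeRing H O hO))} {Q : PMF (FinModClass (heckeRing H' O' hO'))}
    (hP : IsRandomModuleLaw v P) (hQ : IsRandomModuleLaw v' Q)
    {X : FinMod (heckeRing H O hO)} {Y : FinMod (heckeRing H' O' hO')}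
    (f : X.carrier ≃+ Y.carrier) (hf : ∀ a x, f (a • x) = θ a • f x) : P ⟦X⟧ = Q ⟦Y⟧ := by
  set T := FinModClass.transport θ
  have transport_X : T ⟦X⟧ = ⟦Y⟧ :=
    Quotient.sound ((FinMod.transport_equiv_iff θ X Y).mpr ⟨f, hf⟩)
  have weight_eq (c : FinModClass (heckeRing H O hO)) :
      moduleWeight v' (T c).out = moduleWeight v c.out :=
    moduleWeight_eq_of_transport_eq hθ he ha hv <| by rw [Quotient.out_eq, Quotient.out_eq]
  have tsum_Q : ∑' c, Q (T c) = 1 :=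
    ((Equiv.ofBijective T (FinModClass.transport_bijective θ)).tsum_eq Q).trans Q.tsum_coe
  have w_ne_zero (c : FinModClass (heckeRing H O hO)) : moduleWeight v c.out ≠ 0 :=
    moduleWeight_ne_zero hmax v _
  rw [← transport_X, eq_inv_of_tsum_eq_one P.tsum_coe w_ne_zero (fun _ => ENNReal.ofReal_ne_top)
    hP.mul_moduleWeight_out_eq]
  refine (eq_inv_of_tsum_eq_one tsum_Q w_ne_zero (fun _ => ENNReal.ofReal_ne_top) ?_ _).symm
  intro c d
  rw [← weight_eq, ← weight_eq]
  exact hQ.mul_moduleWeight_out_eq _ _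

end Laws

end CohenMartinet

end

theorem mainTheorem10_general
    {K₀ L M : Type*} [Field K₀] [NumberField K₀] [Field L] [Field M]
    [Algebra K₀ L] [Algebra K₀ M] [Algebra L M] [IsScalarTower K₀ L M]
    [FiniteDimensional K₀ L] [FiniteDimensional K₀ M] [IsGalois K₀ L] [IsGalois K₀ M]
    {Γ Ξ : Type*} [Group Γ] [Fintype Γ] [Group Ξ] [Fintype Ξ]
    (τL : Gal(L/K₀) ≃* Γ) (τM : Gal(M/K₀) ≃* Ξ)
    (Γ' : Subgroup Γ) (Ξ' : Subgroup Ξ) (hΞ' : Γ'.comap (restrictHom τL τM) = Ξ')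
    (S : Set Nat.Primes) (hS : ∀ p ∈ S, augIdem Ξ' ∈ groupRing {p} Ξ)
    (φ : Comp (augIdem Γ') → Γ → ℂ) (hφ : ∀ ε, IsAbsIrrCharIn ε.1 (φ ε))
    (ψ : Comp (augIdem Ξ') → Ξ → ℂ) (hψ : ∀ ε, IsAbsIrrCharIn ε.1 (ψ ε)) :
    (∃ β : Comp (augIdem Γ') ≃ Comp (augIdem Ξ'),
      (∀ ε, (β ε).1 = inflation (restrictHom τL τM) (restrictHom_surjective τL τM) ε.1) ∧
      ∀ ε, fixedRank K₀ M τM Ξ' ψ (β ε) = fixedRank K₀ L τL Γ' φ ε) ∧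
    ∀ (O : ZSub S (MonoidAlgebra ℚ Γ)) (O' : ZSub S (MonoidAlgebra ℚ Ξ))
      (hO : IsMaximalOrder S 1 O) (hO' : IsOrder S 1 O'),
      (∀ x ∈ O, cosetSum (restrictHom τL τM) x ∈ O') →
      (∃ ι : leftInv Γ' (lmul (augIdem Γ') O) ≃+ leftInv Ξ' (lmul (augIdem Ξ') O'),
        ∀ x, (ι x : MonoidAlgebra ℚ Ξ) =
          inflation (restrictHom τL τM) (restrictHom_surjective τL τM) x) ∧
      ∃ θ : heckeRing Γ' O hO.1 ≃+* heckeRing Ξ' O' hO',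
        (∀ a, heckeVal (θ a) =
          inflation (restrictHom τL τM) (restrictHom_surjective τL τM) (heckeVal a)) ∧
        (∀ (X : FinMod (heckeRing Γ' O hO.1)) (Y : FinMod (heckeRing Ξ' O' hO'))
          (f : X.carrier ≃+ Y.carrier), (∀ a x, f (a • x) = θ a • f x) →
          cardPow (fixedRank K₀ M τM Ξ' ψ) Y = cardPow (fixedRank K₀ L τL Γ' φ) X) ∧
        ∀ (P : PMF (FinModClass (heckeRing Γ' O hO.1)))
          (Q : PMF (FinModClass (heckeRing Ξ' O' hO'))),
          IsRandomModuleLaw (fixedRank K₀ L τL Γ' φ) P →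
          IsRandomModuleLaw (fixedRank K₀ M τM Ξ' ψ) Q →
          ∀ (X : FinMod (heckeRing Γ' O hO.1)) (Y : FinMod (heckeRing Ξ' O' hO'))
            (f : X.carrier ≃+ Y.carrier), (∀ a x, f (a • x) = θ a • f x) →
            P ⟦X⟧ = Q ⟦Y⟧ := by
  have hπ := restrictHom_surjective τL τM
  have he : inflation _ hπ (augIdem Γ') = augIdem Ξ' := by rw [inflation_augIdem, hΞ']
  have ha : inflation _ hπ (avg Γ') = avg Ξ' := by rw [inflation_avg, hΞ']
  have map_eq : Ξ'.map (restrictHom τL τM) = Γ' := by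
    rw [← hΞ', Subgroup.map_comap_eq_self_of_surjective hπ]
  have hrank := fixedRank_compEquiv τL τM map_eq he hφ hψ
  refine ⟨⟨compEquiv hπ he, fun _ => rfl, hrank⟩, fun O O' hO hO' hc => ?_⟩
  have lmul_eq : lmul (augIdem Ξ') O' = inflate hπ (lmul (augIdem Γ') O) := he ▸
    lmul_inflation_of_isMaximalOrder hπ hO hO' hc (augIdem_spec Γ').1.1.1 fun p hp => he ▸ hS p hp
  have leftInv_eq : leftInv Ξ' (lmul (augIdem Ξ') O') =
      inflate hπ (leftInv Γ' (lmul (augIdem Γ') O)) := by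
    rw [lmul_eq, ← hΞ', leftInv_comap_inflate]
  have heckeModule_eq : heckeModule Ξ' O' = inflate hπ (heckeModule Γ' O) := by
    rw [heckeModule, lmul_eq, ← ha, rmul_inflate, ← hΞ', leftInv_comap_inflate, heckeModule]
  exact ⟨⟨(inflateEquiv leftInv_eq).toAddEquiv, fun _ => rfl⟩,
    heckeEquiv hO.1 hO' heckeModule_eq, fun _ => rfl,
    fun _ _ => cardPow_eq_of_semilinear (fun _ => rfl) he ha hrank,
    fun _ _ hP hQ _ _ => isRandomModuleLaw_apply_eq (fun _ => rfl) he ha hrank hO hP hQ⟩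

theorem mainTheorem10
    {K₀ K L M : Type*} [Field K₀] [NumberField K₀] [Field K] [Field L] [Field M]
    [Algebra K₀ K] [Algebra K₀ L] [Algebra K₀ M] [Algebra K L] [Algebra K M] [Algebra L M]
    [IsScalarTower K₀ K L] [IsScalarTower K₀ K M] [IsScalarTower K₀ L M] [IsScalarTower K L M]
    [FiniteDimensional K₀ K] [FiniteDimensional K₀ L] [FiniteDimensional K₀ M]
    [IsGalois K₀ L] [IsGalois K₀ M] [IsNormalClosure K₀ K L]
    {Γ Ξ : Type*} [Group Γ] [Fintype Γ] [Group Ξ] [Fintype Ξ]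
    (τL : Gal(L/K₀) ≃* Γ) (τM : Gal(M/K₀) ≃* Ξ)
    (Γ' : Subgroup Γ) (hΓ' : Γ' = galImage K₀ L K τL)
    (Ξ' : Subgroup Ξ) (hΞ' : Ξ' = galImage K₀ M K τM)
    (S : Set Nat.Primes)
    (hS : ∀ p ∈ S, IsGoodPrime p (augIdem Γ') ∧ IsGoodPrime p (augIdem Ξ'))
    (φ : Comp (augIdem Γ') → Γ → ℂ) (hφ : ∀ ε, IsAbsIrrCharIn ε.1 (φ ε))
    (ψ : Comp (augIdem Ξ') → Ξ → ℂ) (hψ : ∀ ε, IsAbsIrrCharIn ε.1 (ψ ε)) :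
    -- the ranks agree, under the correspondence of irreducible central idempotents
    (∃ β : Comp (augIdem Γ') ≃ Comp (augIdem Ξ'),
      (∀ ε, (β ε).1 = inflation (restrictHom τL τM) (restrictHom_surjective τL τM) ε.1) ∧
      ∀ ε, fixedRank K₀ M τM Ξ' ψ (β ε) = fixedRank K₀ L τL Γ' φ ε) ∧
    ∀ (O : ZSub S (MonoidAlgebra ℚ Γ)) (O' : ZSub S (MonoidAlgebra ℚ Ξ))
      (hO : IsMaximalOrder S 1 O) (hO' : IsMaximalOrder S 1 O'),
      (∀ x ∈ O, cosetSum (restrictHom τL τM) x ∈ O') →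
      -- the modules of invariants are isomorphic
      (∃ ι : leftInv Γ' (lmul (augIdem Γ') O) ≃+ leftInv Ξ' (lmul (augIdem Ξ') O'),
        ∀ x, (ι x : MonoidAlgebra ℚ Ξ) =
          inflation (restrictHom τL τM) (restrictHom_surjective τL τM) x) ∧
      ∃ θ : heckeRing Γ' O hO.1 ≃+* heckeRing Ξ' O' hO'.1,
        (∀ a, heckeVal (θ a) =
          inflation (restrictHom τL τM) (restrictHom_surjective τL τM) (heckeVal a)) ∧
        -- the predicted distributions agree, under the identification of modules through `θ`
        (∀ (X : FinMod (heckeRing Γ' O hO.1)) (Y : FinMod (heckeRing Ξ' O' hO'.1))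
          (f : X.carrier ≃+ Y.carrier), (∀ a x, f (a • x) = θ a • f x) →
          cardPow (fixedRank K₀ M τM Ξ' ψ) Y = cardPow (fixedRank K₀ L τL Γ' φ) X) ∧
        ∀ (P : PMF (FinModClass (heckeRing Γ' O hO.1)))
          (Q : PMF (FinModClass (heckeRing Ξ' O' hO'.1))),
          IsRandomModuleLaw (fixedRank K₀ L τL Γ' φ) P →
          IsRandomModuleLaw (fixedRank K₀ M τM Ξ' ψ) Q →
          ∀ (X : FinMod (heckeRing Γ' O hO.1)) (Y : FinMod (heckeRing Ξ' O' hO'.1))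
            (f : X.carrier ≃+ Y.carrier), (∀ a x, f (a • x) = θ a • f x) →
            P ⟦X⟧ = Q ⟦Y⟧ := by
  obtain ⟨ranks, orders⟩ := mainTheorem10_general τL τM Γ' Ξ'
    (by rw [hΓ', hΞ', galImage_comap_restrictHom]) S (fun p hp => (hS p hp).2.1) φ hφ ψ hψ
  exact ⟨ranks, fun O O' hO hO' => orders O O' hO hO'.1⟩
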